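/- Let $(Q,\mathfrak n)$ be a commutative noetherian local ring and let $f,g\in\mathfrak n\smallsetminus\mathfrak n^2$ with $fg=0$. Set $R=Q/(f)$, and let $A=Q\langle y,t\mid \partial(y)=f,\ \partial(t)=gy\rangle$ be the Tate construction: the differential graded (dg) $Q$-algebra that is free as a $Q$-module with basis $t^{(i)},\ t^{(i)}y$ ($i\ge 0$) in degrees $2i,\ 2i+1$, with multiplication determined by $t^{(0)}=1$, $y^2=0$, $t^{(i)}t^{(j)}=\binom{i+j}{i}t^{(i+j)}$, $yt^{(i)}=t^{(i)}y$, and with differential $\partial(t^{(i)}y)=f\,t^{(i)}$, $\partial(t^{(0)})=0$, $\partial(t^{(i)})=g\,t^{(i-1)}y$ for $i\ge 1$. Regard $R$ as an $A$-algebra via the augmentation $A\to R$ that is the canonical map $Q\to R$ in degree $0$ and zero in positive degrees. A dg $A$-module is called semi-free if its underlying graded module has a homogeneous basis over the graded algebra underlying $A$. For a finitely generated module $M$ over a noetherian local ring $S$, let $P^S_M(t)=\sum_{n\ge 0}\beta^S_n(M)t^n$, where $\beta^S_n(M)$ is the rank of the $n$-th module in a minimal free resolution of $M$ over $S$. The following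 conditions are equivalent. (1) $(f,g)$ is a pair of exact zero divisors, that is, $\operatorname{ann}(f)=(g)$ and $\operatorname{ann}(g)=(f)$. (2) For every finitely generated $R$-module $M$ and every minimal free resolution $U$ of $M$ over $Q$, the complex $U$ has a semi-free dg $A$-module structure for which $U\otimes_A R$, with the augmentation to $M$ induced by that of $U$, is a minimal free resolution of $M$ over $R$. (2') For every finitely generated $R$-module $M$, every minimal free resolution $U$ of $M$ over $Q$ and every semi-free dg $A$-module structure on the complex $U$, the complex $U\otimes_A R$, with the augmentation to $M$ induced by that of $U$, is a minimal free resolution of $M$ over $R$. (3) For every finitely generated $R$-module $M$, $P^R_M(t)=(1-t)\,P^Q_M(t)$. -/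

import Mathlib

open scoped TensorProduct

universe u

/-! ## Graded complexes, free resolutions, Betti numbers -/

/-- A complex of `Q`-modules concentrated in non-negative homological degrees: a graded
`Q`-module `U = ⨁ n, Uₙ` with a differential `d` of degree `-1`. -/
structure GradedComplex (Q : Type u) [CommRing Q] where
  carrier : Type u
  [addCommGroup : AddCommGroup carrier]
  [module : Module Q carrier]
  deg : ℕ → Submodule Q carrier
  isInternal : DirectSum.IsInternal deg
  d : carrier →ₗ[Q] carrier
  d_deg_zero : ∀ u ∈ deg 0, d u = 0
  d_deg_succ : ∀ n, ∀ u ∈ deg (n + 1), d u ∈ deg n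
  d_d : ∀ u, d (d u) = 0

namespace GradedComplex

instance (Q : Type u) [CommRing Q] : CoeSort (GradedComplex Q) (Type u) := ⟨carrier⟩

attribute [instance] addCommGroup module

/-- `(U, ε)` is a minimal free resolution of the finitely generated module `M` over the local
ring `Q`. The augmentation `ε` is a map to `M` (placed in degree `0`); the augmented sequence
`⋯ → U₂ → U₁ → U₀ → M → 0` is exact, every `Uₙ` is free of finite rank, and
`d U ⊆ 𝔫 U`. -/
structure IsMinimalFreeResolution {Q : Type u} [CommRing Q] [IsLocalRing Q]
    (U : GradedComplex Q) {M : Type u} [AddCommGroup M] [Module Q M] (ε : U →ₗ[Q] M) :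
    Prop where
  free : ∀ n, Module.Free Q (U.deg n)
  finite : ∀ n, Module.Finite Q (U.deg n)
  ε_deg_succ : ∀ n, ∀ u ∈ U.deg (n + 1), ε u = 0
  ε_surjective : Function.Surjective ε
  exact_zero : ∀ u ∈ U.deg 0, ε u = 0 ↔ ∃ v ∈ U.deg 1, U.d v = u
  exact_succ : ∀ n, ∀ u ∈ U.deg (n + 1), U.d u = 0 ↔ ∃ v ∈ U.deg (n + 2), U.d v = u
  minimal : ∀ u, U.d u ∈ IsLocalRing.maximalIdeal Q • (⊤ : Submodule Q U)

end GradedComplex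

open Classical in
/-- The `n`-th Betti number: the rank of the `n`-th module in a minimal free resolution of `M`.
(Over a noetherian local ring every finitely generated module has such a resolution, and any
two are isomorphic; the default value is then never used.) -/
noncomputable def bettiNumber (R : Type u) [CommRing R] [IsLocalRing R]
    (M : Type u) [AddCommGroup M] [Module R M] (n : ℕ) : ℕ :=
  if h : ∃ (F : GradedComplex R) (ε : F →ₗ[R] M), F.IsMinimalFreeResolution ε then
    Module.finrank R (h.choose.deg n)
  else 0

/-- The Poincaré series `P^R_M(t) = ∑ βₙ tⁿ`, as a formal power series over `ℤ`. -/
noncomputable def poincareSeries (R : Type u) [CommRing R] [IsLocalRing R]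
    (M : Type u) [AddCommGroup M] [Module R M] : PowerSeries ℤ :=
  PowerSeries.mk fun n => (bettiNumber R M n : ℤ)

/-- `(f, g)` is a pair of exact zero divisors: `ann f = (g)` and `ann g = (f)`. -/
def IsExactZeroDivisorPair {Q : Type u} [CommRing Q] (f g : Q) : Prop :=
  (Ideal.span {f}).annihilator = Ideal.span {g} ∧ (Ideal.span {g}).annihilator = Ideal.span {f}

theorem isLocalRing_quotient_span {Q : Type u} [CommRing Q] [IsLocalRing Q] {f : Q}
    (hf : f ∈ IsLocalRing.maximalIdeal Q) : IsLocalRing (Q ⧸ Ideal.span {f}) := by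
  have : Nontrivial (Q ⧸ Ideal.span {f}) := by
    rw [Ideal.Quotient.nontrivial_iff, ne_eq, Ideal.span_singleton_eq_top]
    exact hf
  exact IsLocalRing.of_surjective' (Ideal.Quotient.mk (Ideal.span {f})) Ideal.Quotient.mk_surjective

/-! ## The Tate construction `A = Q⟨y, t | ∂ y = f, ∂ t = g y⟩` -/

/-- The underlying module of the Tate construction on `f, g`: the free `Q`-module with basis
`y₀, y₁, y₂, …`, where `y₂ᵢ = t⁽ⁱ⁾` and `y₂ᵢ₊₁ = t⁽ⁱ⁾ y`, and `yₙ` has degree `n`. -/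
def TateAlgebra {Q : Type u} [CommRing Q] (_f _g : Q) : Type u := ℕ →₀ Q

namespace TateAlgebra

/-- The structure constants `yᵢ yⱼ = α i j • yᵢ₊ⱼ`, obtained from `y² = 0` and
`t⁽ᵃ⁾ t⁽ᵇ⁾ = (a + b)! / (a! b!) t⁽ᵃ⁺ᵇ⁾`. -/
def α (i j : ℕ) : ℕ :=
  if i % 2 = 1 ∧ j % 2 = 1 then 0 else ((i + j) / 2).choose (i / 2)

theorem α_comm (i j : ℕ) : α i j = α j i := by
  unfold α
  by_cases h : i % 2 = 1 ∧ j % 2 = 1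
  · rw [if_pos h, if_pos h.symm]
  · rw [if_neg h, if_neg (fun h' => h h'.symm), add_comm j i]
    have : (i + j) / 2 = i / 2 + j / 2 := by omega
    rw [this, Nat.choose_symm_add]

theorem α_zero_left (j : ℕ) : α 0 j = 1 := by simp [α]

theorem α_assoc (i j k : ℕ) : α i j * α (i + j) k = α j k * α i (j + k) := by
  unfold α
  have key : ∀ a b c : ℕ, (a + b).choose a * (a + b + c).choose (a + b) =
      (b + c).choose b * (a + b + c).choose a := by
    intro a b c
    have h := Nat.choose_mul (n := a + b + c) (k := a + b) (s := a) (by omega)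
    have e1 : a + b + c - a = b + c := by omega
    have e2 : a + b - a = b := by omega
    rw [e1, e2] at h
    rw [mul_comm, h, mul_comm]
  have k' := key (i / 2) (j / 2) (k / 2)
  by_cases h : (i % 2 = 1 ∧ j % 2 = 1) ∨ (i % 2 = 1 ∧ k % 2 = 1) ∨ (j % 2 = 1 ∧ k % 2 = 1)
  · split_ifs <;> first | (exfalso; omega) | simp only [zero_mul, mul_zero]
  · rw [if_neg (by omega), if_neg (by omega), if_neg (by omega), if_neg (by omega)]
    have e1 : (i + j) / 2 = i / 2 + j / 2 := by omega
    have e2 : (i + j + k) / 2 = i / 2 + j / 2 + k / 2 := by omega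
    have e3 : (j + k) / 2 = j / 2 + k / 2 := by omega
    have e4 : (i + (j + k)) / 2 = i / 2 + j / 2 + k / 2 := by omega
    rw [e1, e2, e3, e4]
    exact k'

variable {Q : Type u} [CommRing Q] (f g : Q)

noncomputable instance : AddCommGroup (TateAlgebra f g) :=
  inferInstanceAs (AddCommGroup (ℕ →₀ Q))

noncomputable instance : Module Q (TateAlgebra f g) :=
  inferInstanceAs (Module Q (ℕ →₀ Q))

/-- The basis `y₀, y₁, y₂, …`. -/
noncomputable def basis : Module.Basis ℕ Q (TateAlgebra f g) := ⟨LinearEquiv.refl Q (ℕ →₀ Q)⟩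

/-- The basis element `yₙ`. -/
noncomputable abbrev y (n : ℕ) : TateAlgebra f g := basis f g n

/-- The `Q`-bilinear multiplication with `yᵢ yⱼ = α i j • yᵢ₊ⱼ`. -/
noncomputable def mulHom : TateAlgebra f g →ₗ[Q] TateAlgebra f g →ₗ[Q] TateAlgebra f g :=
  (basis f g).constr Q fun i => (basis f g).constr Q fun j => (α i j : Q) • y f g (i + j)

noncomputable instance : Mul (TateAlgebra f g) := ⟨fun a b => mulHom f g a b⟩

noncomputable instance : One (TateAlgebra f g) := ⟨y f g 0⟩

theorem mul_def (a b : TateAlgebra f g) : a * b = mulHom f g a b := rfl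

theorem one_def : (1 : TateAlgebra f g) = y f g 0 := rfl

theorem y_mul_y (i j : ℕ) : y f g i * y f g j = (α i j : Q) • y f g (i + j) := by
  rw [mul_def, mulHom, Module.Basis.constr_basis, Module.Basis.constr_basis]

theorem basis_induction {p : TateAlgebra f g → Prop} (hy : ∀ n, p (y f g n)) (h0 : p 0)
    (hadd : ∀ a b, p a → p b → p (a + b)) (hsmul : ∀ (r : Q) a, p a → p (r • a))
    (a : TateAlgebra f g) : p a := by
  have ha : a ∈ Submodule.span Q (Set.range (basis f g)) := by
    rw [(basis f g).span_eq]; trivial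
  induction ha using Submodule.span_induction with
  | mem x hx => obtain ⟨n, rfl⟩ := hx; exact hy n
  | zero => exact h0
  | add a b _ _ ha hb => exact hadd a b ha hb
  | smul r a _ ha => exact hsmul r a ha

theorem mulHom_comm : (mulHom f g).flip = mulHom f g := by
  refine (basis f g).ext fun i => (basis f g).ext fun j => ?_
  rw [LinearMap.flip_apply, ← mul_def, ← mul_def, y_mul_y, y_mul_y, α_comm, add_comm]

noncomputable instance : CommRing (TateAlgebra f g) where
  __ := (inferInstance : AddCommGroup (TateAlgebra f g))
  mul_assoc a b c := by
    simp only [mul_def]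
    induction a using basis_induction with
    | h0 => simp
    | hadd a b ha hb => simp [ha, hb]
    | hsmul r a ha => simp [ha]
    | hy i =>
    induction b using basis_induction with
    | h0 => simp
    | hadd a b ha hb => simp [ha, hb]
    | hsmul r a ha => simp [ha]
    | hy j =>
    induction c using basis_induction with
    | h0 => simp
    | hadd a b ha hb => simp [ha, hb]
    | hsmul r a ha => simp [ha]
    | hy k =>
    simp only [← mul_def, y_mul_y]
    simp only [mul_def, map_smul, LinearMap.smul_apply]
    simp only [← mul_def, y_mul_y, smul_smul, add_assoc]
    rw [← Nat.cast_mul, ← Nat.cast_mul, α_assoc]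
  mul_comm a b := by
    rw [mul_def, ← mulHom_comm, LinearMap.flip_apply, mul_def]
  one_mul a := by
    have h : mulHom f g (y f g 0) = LinearMap.id := by
      refine (basis f g).ext fun j => ?_
      rw [← mul_def, y_mul_y, α_zero_left, zero_add]; simp
    rw [one_def, mul_def, h, LinearMap.id_apply]
  mul_one a := by
    have h : mulHom f g (y f g 0) = LinearMap.id := by
      refine (basis f g).ext fun j => ?_
      rw [← mul_def, y_mul_y, α_zero_left, zero_add]; simp
    rw [one_def, mul_def, ← mulHom_comm, LinearMap.flip_apply, h, LinearMap.id_apply]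
  left_distrib a b c := by simp only [mul_def, map_add]
  right_distrib a b c := by simp only [mul_def, map_add, LinearMap.add_apply]
  zero_mul a := by simp only [mul_def, map_zero, LinearMap.zero_apply]
  mul_zero a := by simp only [mul_def, map_zero]

noncomputable instance : Algebra Q (TateAlgebra f g) :=
  Algebra.ofModule
    (fun r a b => by simp only [mul_def, map_smul, LinearMap.smul_apply])
    (fun r a b => by simp only [mul_def, map_smul])

/-- The degree `n` component `Q yₙ`. -/
noncomputable def deg (n : ℕ) : Submodule Q (TateAlgebra f g) := Submodule.span Q {y f g n}

/-- The coefficients `f₁ = f, f₂ = g, f₃ = f, …` of the differential. -/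
def coeff (n : ℕ) : Q := if n % 2 = 1 then f else g

/-- The differential: `∂ (yₙ₊₁) = fₙ₊₁ yₙ` and `∂ y₀ = 0`, i.e. `∂ (t⁽ⁱ⁾ y) = f t⁽ⁱ⁾` and
`∂ t⁽ⁱ⁾ = g y t⁽ⁱ⁻¹⁾`. -/
noncomputable def d : TateAlgebra f g →ₗ[Q] TateAlgebra f g :=
  (basis f g).constr Q fun n => match n with
    | 0 => 0
    | n + 1 => coeff f g (n + 1) • y f g n

theorem d_y_zero : d f g (y f g 0) = 0 := (basis f g).constr_basis ..

theorem d_y_succ (n : ℕ) : d f g (y f g (n + 1)) = coeff f g (n + 1) • y f g n :=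
  (basis f g).constr_basis ..

theorem d_d (hfg : f * g = 0) (a : TateAlgebra f g) : d f g (d f g a) = 0 := by
  induction a using basis_induction with
  | h0 => simp
  | hadd a b ha hb => simp [ha, hb]
  | hsmul r a ha => simp [ha]
  | hy n =>
  match n with
  | 0 => rw [d_y_zero, map_zero]
  | 1 => rw [d_y_succ, map_smul, d_y_zero, smul_zero]
  | n + 2 =>
    rw [d_y_succ, map_smul, d_y_succ, smul_smul]
    have : coeff f g (n + 1 + 1) * coeff f g (n + 1) = 0 := by
      unfold coeff
      rcases Nat.mod_two_eq_zero_or_one n with h | h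
      · rw [if_neg (by omega), if_pos (by omega), mul_comm, hfg]
      · rw [if_pos (by omega), if_neg (by omega), hfg]
    rw [this, zero_smul]

theorem coeff_α (i j : ℕ) :
    (α i (j + 1) : Q) * coeff f g (i + 1) + (-1) ^ (i + 1) * (α (i + 1) j * coeff f g (j + 1)) =
      α (i + 1) (j + 1) * coeff f g (i + 1 + (j + 1)) := by
  have pascal : ∀ a b : ℕ, (a + b + 2).choose (a + 1) =
      (a + b + 1).choose a + (a + b + 1).choose (a + 1) := fun a b => Nat.choose_succ_succ _ _
  rcases Nat.even_or_odd' i with ⟨a, rfl | rfl⟩ <;> rcases Nat.even_or_odd' j with ⟨b, rfl | rfl⟩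
  · have e : ((-1 : Q)) ^ (2 * a + 1) = -1 := by rw [pow_succ, pow_mul]; simp
    have h1 : α (2 * a) (2 * b + 1) = (a + b).choose a := by
      unfold α; rw [if_neg (by omega)]; congr 1 <;> omega
    have h2 : α (2 * a + 1) (2 * b) = (a + b).choose a := by
      unfold α; rw [if_neg (by omega)]; congr 1 <;> omega
    have h3 : α (2 * a + 1) (2 * b + 1) = 0 := by unfold α; rw [if_pos (by omega)]
    have c1 : coeff f g (2 * a + 1) = f := if_pos (by omega)
    have c2 : coeff f g (2 * b + 1) = f := if_pos (by omega)
    rw [e, h1, h2, h3, c1, c2]; push_cast; ring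
  · have h1 : α (2 * a) (2 * b + 1 + 1) = (a + b + 1).choose a := by
      unfold α; rw [if_neg (by omega)]; congr 1 <;> omega
    have h2 : α (2 * a + 1) (2 * b + 1) = 0 := by unfold α; rw [if_pos (by omega)]
    have h3 : α (2 * a + 1) (2 * b + 1 + 1) = (a + b + 1).choose a := by
      unfold α; rw [if_neg (by omega)]; congr 1 <;> omega
    have c1 : coeff f g (2 * a + 1) = f := if_pos (by omega)
    have c3 : coeff f g (2 * a + 1 + (2 * b + 1 + 1)) = f := if_pos (by omega)
    rw [h1, h2, h3, c1, c3]; push_cast; ring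
  · have e : ((-1 : Q)) ^ (2 * a + 1 + 1) = 1 := by rw [pow_succ, pow_succ, pow_mul]; simp
    have h1 : α (2 * a + 1) (2 * b + 1) = 0 := by unfold α; rw [if_pos (by omega)]
    have h2 : α (2 * a + 1 + 1) (2 * b) = (a + b + 1).choose (a + 1) := by
      unfold α; rw [if_neg (by omega)]; congr 1 <;> omega
    have h3 : α (2 * a + 1 + 1) (2 * b + 1) = (a + b + 1).choose (a + 1) := by
      unfold α; rw [if_neg (by omega)]; congr 1 <;> omega
    have c2 : coeff f g (2 * b + 1) = f := if_pos (by omega)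
    have c3 : coeff f g (2 * a + 1 + 1 + (2 * b + 1)) = f := if_pos (by omega)
    rw [e, h1, h2, h3, c2, c3]; push_cast; ring
  · have e : ((-1 : Q)) ^ (2 * a + 1 + 1) = 1 := by rw [pow_succ, pow_succ, pow_mul]; simp
    have h1 : α (2 * a + 1) (2 * b + 1 + 1) = (a + b + 1).choose a := by
      unfold α; rw [if_neg (by omega)]; congr 1 <;> omega
    have h2 : α (2 * a + 1 + 1) (2 * b + 1) = (a + b + 1).choose (a + 1) := by
      unfold α; rw [if_neg (by omega)]; congr 1 <;> omega
    have h3 : α (2 * a + 1 + 1) (2 * b + 1 + 1) = (a + b + 2).choose (a + 1) := by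
      unfold α; rw [if_neg (by omega)]; congr 1 <;> omega
    have c1 : coeff f g (2 * a + 1 + 1) = g := if_neg (by omega)
    have c2 : coeff f g (2 * b + 1 + 1) = g := if_neg (by omega)
    have c3 : coeff f g (2 * a + 1 + 1 + (2 * b + 1 + 1)) = g := if_neg (by omega)
    rw [e, h1, h2, h3, c1, c2, c3, pascal]; push_cast; ring

/-- The Leibniz rule: `A` is a dg algebra. -/
theorem leibniz (i : ℕ) (a b : TateAlgebra f g) (ha : a ∈ deg f g i) :
    d f g (a * b) = d f g a * b + (-1) ^ i * (a * d f g b) := by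
  obtain ⟨r, rfl⟩ := Submodule.mem_span_singleton.1 ha
  simp only [map_smul, smul_mul_assoc, mul_smul_comm, ← smul_add]
  congr 1
  induction b using basis_induction with
  | h0 => simp
  | hadd a b ha hb => simp only [mul_add, map_add, ha, hb]; abel
  | hsmul r a ha => simp only [map_smul, mul_smul_comm, ← smul_add, ha]
  | hy j =>
  match i, j with
  | 0, j => rw [← one_def, one_mul, one_def, d_y_zero, ← one_def]; simp
  | i + 1, 0 => rw [← one_def, mul_one, one_def, d_y_zero, ← one_def]; simp
  | i + 1, j + 1 =>
    have hs : ((-1 : TateAlgebra f g)) ^ (i + 1) =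
        algebraMap Q (TateAlgebra f g) ((-1) ^ (i + 1)) := by simp
    rw [hs, ← Algebra.smul_def, y_mul_y, map_smul, d_y_succ, d_y_succ,
      smul_mul_assoc, mul_smul_comm, y_mul_y, y_mul_y,
      show i + 1 + (j + 1) = i + 1 + j + 1 from rfl, d_y_succ,
      show i + (j + 1) = i + 1 + j by omega]
    simp only [smul_smul, ← add_smul]
    congr 1
    have h := coeff_α f g i j
    rw [show i + 1 + (j + 1) = i + 1 + j + 1 from rfl] at h
    rw [← h]
    ring

/-- The augmentation `ε : A → A/(A_{≥1}, ∂ A₁) = Q/(f)`, with `y₀ ↦ 1` and `yₙ ↦ 0` for `n ≥ 1`,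
as a linear map. -/
noncomputable def augHom : TateAlgebra f g →ₗ[Q] Q ⧸ Ideal.span {f} :=
  (basis f g).constr Q fun n => if n = 0 then 1 else 0

theorem augHom_y (n : ℕ) : augHom f g (y f g n) = if n = 0 then 1 else 0 :=
  (basis f g).constr_basis ..

/-- The augmentation `ε : A → R = Q/(f)`, a homomorphism of algebras. -/
noncomputable def aug : TateAlgebra f g →ₐ[Q] Q ⧸ Ideal.span {f} :=
  AlgHom.ofLinearMap (augHom f g) (by rw [one_def, augHom_y, if_pos rfl]) (fun a b => by
    induction a using basis_induction with
    | h0 => simp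
    | hadd a b ha hb => simp [ha, hb, add_mul]
    | hsmul r a ha => simp [ha]
    | hy i =>
    induction b using basis_induction with
    | h0 => simp
    | hadd a b ha hb => simp [ha, hb, mul_add]
    | hsmul r a ha => simp [ha]
    | hy j =>
    rw [y_mul_y, map_smul, augHom_y, augHom_y, augHom_y]
    rcases Nat.eq_zero_or_pos i with hi | hi
    · subst hi
      simp [α_zero_left]
    · rw [if_neg (by omega), if_neg (by omega), smul_zero, zero_mul])

/-- `R = Q/(f)` is an `A`-algebra through the augmentation. -/
noncomputable instance : Algebra (TateAlgebra f g) (Q ⧸ Ideal.span {f}) :=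
  (aug f g).toRingHom.toAlgebra

theorem algebraMap_y (n : ℕ) :
    algebraMap (TateAlgebra f g) (Q ⧸ Ideal.span {f}) (y f g n) = if n = 0 then 1 else 0 :=
  augHom_y f g n

instance : IsScalarTower Q (TateAlgebra f g) (Q ⧸ Ideal.span {f}) :=
  IsScalarTower.of_algebraMap_eq fun r => ((aug f g).commutes r).symm

end TateAlgebra

/-! ## Differential graded modules over the Tate construction -/

section DGModule

variable {Q : Type u} [CommRing Q] (f g : Q)

/-- An action of `A` on the graded module underlying the complex `U` which makes `U` a
dg module over `A = Q⟨y, t | ∂ y = f, ∂ t = g y⟩`. -/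
class IsDGModule (U : GradedComplex Q) [Module (TateAlgebra f g) U] : Prop extends
    IsScalarTower Q (TateAlgebra f g) U where
  smul_mem_deg : ∀ (i n : ℕ) (a : TateAlgebra f g) (u : U),
    a ∈ TateAlgebra.deg f g i → u ∈ U.deg n → a • u ∈ U.deg (i + n)
  leibniz : ∀ (i : ℕ) (a : TateAlgebra f g) (u : U), a ∈ TateAlgebra.deg f g i →
    U.d (a • u) = TateAlgebra.d f g a • u + (-1 : ℤ) ^ i • (a • U.d u)

/-- The dg module `U` is semi-free: the graded module underlying `U` is free over the graded
algebra underlying `A`, i.e. it has an `A`-basis consisting of homogeneous elements. -/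
def IsSemiFree (U : GradedComplex Q) [Module (TateAlgebra f g) U] : Prop :=
  ∃ (Λ : Type u) (e : Module.Basis Λ (TateAlgebra f g) U), ∀ l, ∃ n, e l ∈ U.deg n

end DGModule

/-! ## The complex `U ⊗_A R` -/

namespace GradedComplex

section proj

variable {Q : Type u} [CommRing Q] (U : GradedComplex Q)

theorem bijective_coeLinearMap : Function.Bijective (DirectSum.coeLinearMap U.deg) := U.isInternal

/-- The projection of `U` to its component of degree `m`. -/
noncomputable def proj (m : ℕ) : U →ₗ[Q] U :=
  (U.deg m).subtype ∘ₗ DirectSum.component Q ℕ (fun n => U.deg n) m ∘ₗ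
    (LinearEquiv.ofBijective (DirectSum.coeLinearMap U.deg) U.bijective_coeLinearMap).symm.toLinearMap

theorem proj_of_mem {k : ℕ} {u : U} (hu : u ∈ U.deg k) (m : ℕ) :
    U.proj m u = if k = m then u else 0 := by
  have h : (LinearEquiv.ofBijective (DirectSum.coeLinearMap U.deg) U.bijective_coeLinearMap).symm u =
      DirectSum.lof Q ℕ (fun n => U.deg n) k ⟨u, hu⟩ := by
    rw [LinearEquiv.symm_apply_eq]
    simp
  simp only [proj, LinearMap.comp_apply, LinearEquiv.coe_coe, h]
  by_cases hk : k = m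
  · subst hk; simp [DirectSum.component.lof_self]
  · rw [if_neg hk, DirectSum.component.of, dif_neg hk, map_zero]

theorem induction_deg {p : U → Prop} (hdeg : ∀ n, ∀ u ∈ U.deg n, p u)
    (hadd : ∀ u v, p u → p v → p (u + v)) (u : U) : p u := by
  have hu : u ∈ ⨆ n, U.deg n := by rw [U.isInternal.submodule_iSup_eq_top]; trivial
  induction hu using Submodule.iSup_induction' with
  | mem n u hu => exact hdeg n u hu
  | zero => exact hdeg 0 0 (zero_mem _)
  | add u v _ _ hu hv => exact hadd u v hu hv

end proj

section tensor

variable {Q : Type u} [CommRing Q] {f g : Q} (U : GradedComplex Q)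
  [Module (TateAlgebra f g) U]

/-- The module underlying `U ⊗_A R`, with `R = Q/(f)` on the left. -/
abbrev TensorCarrier (f g : Q) (U : GradedComplex Q) [Module (TateAlgebra f g) U] : Type u :=
  (Q ⧸ Ideal.span {f}) ⊗[TateAlgebra f g] U

/-- The map `U → U ⊗_A R`, `u ↦ u ⊗ 1`. -/
noncomputable def toTensor : U →ₗ[TateAlgebra f g] TensorCarrier f g U :=
  TensorProduct.mk (TateAlgebra f g) (Q ⧸ Ideal.span {f}) U 1

theorem toTensor_y_smul {n : ℕ} (hn : n ≠ 0) (u : U) :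
    (U.toTensor (TateAlgebra.y f g n • u) : TensorCarrier f g U) = 0 := by
  rw [map_smul]
  change TateAlgebra.y f g n • ((1 : Q ⧸ Ideal.span {f}) ⊗ₜ[TateAlgebra f g] u) = 0
  rw [TensorProduct.smul_tmul', Algebra.smul_def, TateAlgebra.algebraMap_y, if_neg hn, zero_mul,
    TensorProduct.zero_tmul]

/-- The component of degree `n` of `U ⊗_A R`, generated by the `u ⊗ 1` with `u ∈ Uₙ`. -/
noncomputable def tensorDeg (f g : Q) (U : GradedComplex Q) [Module (TateAlgebra f g) U] (n : ℕ) :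
    Submodule (Q ⧸ Ideal.span {f}) (TensorCarrier f g U) :=
  Submodule.span _ (U.toTensor '' (U.deg n : Set U))

theorem tensorDeg_iSup : ⨆ n, tensorDeg f g U n = ⊤ := by
  rw [eq_top_iff]
  rintro x -
  induction x using TensorProduct.induction_on with
  | zero => exact zero_mem _
  | add x y hx hy => exact add_mem hx hy
  | tmul r u =>
    have h : ∀ u : U, r ⊗ₜ[TateAlgebra f g] u = r • (U.toTensor u : TensorCarrier f g U) := by
      intro u
      change _ = r • ((1 : Q ⧸ Ideal.span {f}) ⊗ₜ[TateAlgebra f g] u)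
      rw [TensorProduct.smul_tmul', smul_eq_mul, mul_one]
    rw [h]
    refine Submodule.smul_mem _ _ ?_
    clear h
    induction u using induction_deg with
    | hadd u v hu hv => rw [map_add]; exact add_mem hu hv
    | hdeg n u hu => exact Submodule.mem_iSup_of_mem n (Submodule.subset_span ⟨u, hu, rfl⟩)

variable [IsDGModule f g U]

theorem toTensor_smul (r : Q) (u : U) :
    (U.toTensor (r • u) : TensorCarrier f g U) =
      (Ideal.Quotient.mk (Ideal.span {f}) r) • U.toTensor u := by
  rw [← algebraMap_smul (TateAlgebra f g) r u, map_smul]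
  change _ • ((1 : Q ⧸ Ideal.span {f}) ⊗ₜ[TateAlgebra f g] u) = _ • (_ ⊗ₜ[TateAlgebra f g] u)
  rw [TensorProduct.smul_tmul', TensorProduct.smul_tmul', Algebra.smul_def,
    ← IsScalarTower.algebraMap_apply Q (TateAlgebra f g)]
  rfl

/-- A `Q`-linear map `φ : U → U` with `φ (A_{≥1} U) ⊗ 1 = 0` induces the `R`-linear map
`u ⊗ r ↦ φ u ⊗ r` of `U ⊗_A R`. -/
noncomputable def tensorMap (φ : U →ₗ[Q] U)
    (hφ : ∀ n ≠ 0, ∀ u : U, (U.toTensor (φ (TateAlgebra.y f g n • u)) : TensorCarrier f g U) = 0) :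
    TensorCarrier f g U →ₗ[Q ⧸ Ideal.span {f}] TensorCarrier f g U :=
  LinearMap.liftBaseChange (Q ⧸ Ideal.span {f})
    { toFun := fun u => U.toTensor (φ u)
      map_add' := fun u v => by simp only [map_add]
      map_smul' := fun a u => by
        simp only [RingHom.id_apply]
        induction a using TateAlgebra.basis_induction with
        | h0 => simp
        | hadd a b ha hb => simp only [add_smul, map_add, ha, hb]
        | hsmul r a ha =>
          rw [smul_assoc, map_smul, toTensor_smul, ha, smul_assoc]
          rw [← algebraMap_smul (Q ⧸ Ideal.span {f}) r]
          rfl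
        | hy n =>
          by_cases hn : n = 0
          · subst hn
            rw [← TateAlgebra.one_def, one_smul, one_smul]
          · rw [hφ n hn, ← map_smul, toTensor_y_smul U hn] }

theorem tensorMap_toTensor (φ : U →ₗ[Q] U)
    (hφ : ∀ n ≠ 0, ∀ u : U, (U.toTensor (φ (TateAlgebra.y f g n • u)) : TensorCarrier f g U) = 0)
    (u : U) : U.tensorMap φ hφ (U.toTensor u) = U.toTensor (φ u) := by
  change LinearMap.liftBaseChange _ _ (1 ⊗ₜ u) = _
  rw [LinearMap.liftBaseChange_tmul, one_smul]
  rfl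

theorem toTensor_d_y_smul {n : ℕ} (hn : n ≠ 0) (u : U) :
    (U.toTensor (U.d (TateAlgebra.y f g n • u)) : TensorCarrier f g U) = 0 := by
  obtain ⟨n, rfl⟩ := Nat.exists_eq_succ_of_ne_zero hn
  rw [IsDGModule.leibniz (n + 1) _ _ (Submodule.mem_span_singleton_self _), map_add, map_zsmul,
    toTensor_y_smul U hn, smul_zero, add_zero, TateAlgebra.d_y_succ, smul_assoc, toTensor_smul]
  by_cases h0 : n = 0
  · subst h0
    have : Ideal.Quotient.mk (Ideal.span {f}) (TateAlgebra.coeff f g (0 + 1)) = 0 := by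
      rw [Ideal.Quotient.eq_zero_iff_mem]
      exact Ideal.mem_span_singleton_self f
    rw [this, zero_smul]
  · rw [toTensor_y_smul U h0, smul_zero]

theorem toTensor_proj_y_smul (m : ℕ) {n : ℕ} (hn : n ≠ 0) (u : U) :
    (U.toTensor (U.proj m (TateAlgebra.y f g n • u)) : TensorCarrier f g U) = 0 := by
  induction u using induction_deg with
  | hadd u v hu hv => simp only [smul_add, map_add, hu, hv, add_zero]
  | hdeg k u hu =>
    rw [U.proj_of_mem (IsDGModule.smul_mem_deg n k _ u (Submodule.mem_span_singleton_self _) hu)]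
    split_ifs
    · exact toTensor_y_smul U hn u
    · exact map_zero _

theorem tensorDeg_isInternal : DirectSum.IsInternal (tensorDeg f g U) := by
  refine DirectSum.isInternal_submodule_of_iSupIndep_of_iSup_eq_top ?_ (tensorDeg_iSup U)
  let P : ℕ → TensorCarrier f g U →ₗ[Q ⧸ Ideal.span {f}] TensorCarrier f g U :=
    fun m => U.tensorMap (U.proj m) fun _ => toTensor_proj_y_smul U m
  have hP : ∀ m k, ∀ x ∈ tensorDeg f g U k, P m x = if k = m then x else 0 := by
    intro m k x hx
    induction hx using Submodule.span_induction with
    | mem x hx =>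
      obtain ⟨u, hu, rfl⟩ := hx
      change U.tensorMap (U.proj m) _ (U.toTensor u) = _
      rw [tensorMap_toTensor, U.proj_of_mem hu]
      split_ifs
      · rfl
      · exact map_zero _
    | zero => simp
    | add x y _ _ hx hy => rw [map_add, hx, hy]; split_ifs <;> simp
    | smul r x _ hx => rw [map_smul, hx]; split_ifs <;> simp
  rw [iSupIndep_def]
  intro m
  rw [Submodule.disjoint_def]
  intro x hx hx'
  have h1 : P m x = x := by rw [hP m m x hx, if_pos rfl]
  have h2 : (⨆ j, ⨆ (_ : j ≠ m), tensorDeg f g U j) ≤ LinearMap.ker (P m) :=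
    iSup₂_le fun j hj y hy => by rw [LinearMap.mem_ker, hP m j y hy, if_neg hj]
  rw [← h1]
  exact LinearMap.mem_ker.1 (h2 hx')

/-- The complex of `R`-modules `U ⊗_A R`, with differential `∂ (u ⊗ r) = ∂ u ⊗ r`. -/
noncomputable def tensor (f g : Q) (U : GradedComplex Q) [Module (TateAlgebra f g) U]
    [IsDGModule f g U] : GradedComplex (Q ⧸ Ideal.span {f}) where
  carrier := TensorCarrier f g U
  deg := tensorDeg f g U
  isInternal := tensorDeg_isInternal U
  d := U.tensorMap U.d fun _ => toTensor_d_y_smul U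
  d_deg_zero x hx := by
    induction hx using Submodule.span_induction with
    | mem x hx =>
      obtain ⟨u, hu, rfl⟩ := hx
      rw [tensorMap_toTensor, U.d_deg_zero u hu, map_zero]
    | zero => exact map_zero _
    | add x y _ _ hx hy => rw [map_add, hx, hy, add_zero]
    | smul r x _ hx => rw [map_smul, hx, smul_zero]
  d_deg_succ n x hx := by
    induction hx using Submodule.span_induction with
    | mem x hx =>
      obtain ⟨u, hu, rfl⟩ := hx
      rw [tensorMap_toTensor]
      exact Submodule.subset_span ⟨_, U.d_deg_succ n u hu, rfl⟩
    | zero => rw [map_zero]; exact zero_mem _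
    | add x y _ _ hx hy => rw [map_add]; exact add_mem hx hy
    | smul r x _ hx => rw [map_smul]; exact Submodule.smul_mem _ _ hx
  d_d x := by
    have hx : x ∈ ⨆ n, tensorDeg f g U n := by rw [tensorDeg_iSup]; trivial
    induction hx using Submodule.iSup_induction' with
    | zero => simp only [map_zero]
    | add x y _ _ hx hy => simp only [map_add, hx, hy, add_zero]
    | mem n x hx =>
    induction hx using Submodule.span_induction with
    | mem x hx =>
      obtain ⟨u, hu, rfl⟩ := hx
      rw [tensorMap_toTensor, tensorMap_toTensor, U.d_d, map_zero]
    | zero => simp only [map_zero]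
    | add x y _ _ hx hy => rw [map_add, map_add, hx, hy, add_zero]
    | smul r x _ hx => rw [map_smul, map_smul, hx, smul_zero]

end tensor

end GradedComplex

/-- `U ⊗_A R` is a minimal free resolution of `M` over the local ring `R = Q/(f)`, with the
augmentation induced by `ε : U → M`. -/
def IsMinimalFreeResolutionTensor {Q : Type u} [CommRing Q] (f g : Q)
    [IsLocalRing (Q ⧸ Ideal.span {f})] (U : GradedComplex Q) [Module (TateAlgebra f g) U]
    [IsDGModule f g U] {M : Type u} [AddCommGroup M] [Module Q M]
    [Module (Q ⧸ Ideal.span {f}) M] (ε : U →ₗ[Q] M) : Prop :=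
  ∃ ε' : U.tensor f g →ₗ[Q ⧸ Ideal.span {f}] M,
    (∀ u : U, ε' (U.toTensor u : GradedComplex.TensorCarrier f g U) = ε u) ∧
      (U.tensor f g).IsMinimalFreeResolution ε'

/-! ### Nakayama-type linear algebra over a local ring. -/

section LocalAlgebra

open IsLocalRing

variable {Q : Type*} [CommRing Q]

/-! Write 𝔫 for the maximal ideal of Q and f₁ = f, f₂ = g, f₃ = f, …, so that ∂yₙ = fₙ yₙ₋₁ in A.
The implications run in the cycle (1) ⇒ (2') ⇒ (2) ⇒ (3) ⇒ (1).

(1) ⇒ (2'). For an exact pair the augmentation ideal J of A is acyclic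
(`IsExactZeroDivisorPair.exists_d_eq`). A semi-free U is filtered by the degrees of its basis
elements, with subquotients that are sums of shifts of A. Hence JU, the kernel of U → U ⊗_A R, is
acyclic as well (`exists_d_eq_of_toTensor_eq_zero`), and U ⊗_A R still resolves M. Minimality is
inherited from U.

(2') ⇒ (2). A semi-free structure on U always exists, whether or not the pair is exact
(`exists_semiFree`). A semi-free module with a map to U is enlarged one degree m at a time, by
symbols that complete the elements already present to a basis of Uₘ. The images of the yₙ e are
found by exactness of U, using that f kills M. The crux is that the map stays injective modulo 𝔫
(`indepModMaxOn_succ`): if a combination in higher degree lies in 𝔫U, its boundary lies in 𝔫²U by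
minimality, and the leading coefficients of the boundary are f or g times those of the combination.
Since f and g lie outside 𝔫², the latter are nonunits.

(2) ⇒ (3). The yₙ e_l form a Q-basis of U and the e_l ⊗ 1 an R-basis of U ⊗_A R. Each e_l thus
contributes one basis element over Q to every degree from its own upwards, so P^Q = P^R/(1 - t)
(`poincareSeries_eq`).

(3) ⇒ (1). For M = R all Betti numbers over Q are 1, so the resolution consists of multiplications
by h₀, h₁, … in 𝔫 with (h₀) = (f) and ann(hₙ) = (hₙ₊₁). Then g ∈ (h₁) and g ∉ 𝔫² force h₁ to be a
unit multiple of g, and likewise h₂ of f (`isExactZeroDivisorPair_of_bettiNumber_eq_one`). -/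

theorem Module.Basis.mem_smul_top_iff_repr {κ P : Type*} [AddCommGroup P] [Module Q P]
    (b : Module.Basis κ Q P) (I : Ideal Q) (x : P) :
    x ∈ I • (⊤ : Submodule Q P) ↔ ∀ i, b.repr x i ∈ I := by
  constructor
  · intro hx i
    induction hx using Submodule.smul_induction_on' with
    | smul r hr n _ => simpa using I.mul_mem_right _ hr
    | add x _ y _ hx hy => simpa using I.add_mem hx hy
  · intro h
    rw [← b.linearCombination_repr x, Finsupp.linearCombination_apply]
    exact Submodule.sum_mem _ fun i _ => Submodule.smul_mem_smul (h i) trivial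

variable [IsLocalRing Q]

variable (Q) in
/-- The restriction to `S` of the family `v` is linearly independent modulo the maximal ideal. -/
def IndepModMaxOn {κ P : Type*} [AddCommGroup P] [Module Q P] (v : κ → P) (S : Set κ) : Prop :=
  ∀ c ∈ Finsupp.supported Q Q S,
    Finsupp.linearCombination Q v c ∈ maximalIdeal Q • (⊤ : Submodule Q P) →
      ∀ i, c i ∈ maximalIdeal Q

/-- Lift a basis of N/𝔫N: the lifts generate N by Nakayama, and independence over the residue field
puts the coefficients of every relation in 𝔫. -/
theorem exists_surjective_of_fin_ker_le (N : Type*) [AddCommGroup N] [Module Q N]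
    [Module.Finite Q N] : ∃ (b : ℕ) (p : (Fin b → Q) →ₗ[Q] N), Function.Surjective p ∧
      ∀ x, p x = 0 → ∀ i, x i ∈ maximalIdeal Q := by
  let := Ideal.Quotient.field (maximalIdeal Q)
  let V := N ⧸ (maximalIdeal Q • (⊤ : Submodule Q N))
  have : Module.Finite (Q ⧸ maximalIdeal Q) V := Module.Finite.of_restrictScalars_finite Q _ _
  let e := Module.finBasis (Q ⧸ maximalIdeal Q) V
  choose v hv using fun i => Submodule.mkQ_surjective _ (e i)
  refine ⟨_, Fintype.linearCombination Q v, ?_, ?_⟩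
  · rw [← LinearMap.range_eq_top, ← map_mkQ_eq_top, eq_top_iff]
    rintro y -
    obtain ⟨c, hc⟩ : ∃ c : Fin _ → Q, ∀ i, Ideal.Quotient.mk _ (c i) = e.repr y i := by
      choose c hc using fun i => Ideal.Quotient.mk_surjective (e.repr y i)
      exact ⟨c, hc⟩
    refine ⟨Fintype.linearCombination Q v c, ⟨c, rfl⟩, ?_⟩
    rw [Fintype.linearCombination_apply, map_sum, ← e.sum_repr y]
    refine Finset.sum_congr rfl fun i _ => ?_
    rw [map_smul, hv, ← hc]
    rfl
  · intro x hx i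
    have h : ∑ i, (Ideal.Quotient.mk (maximalIdeal Q) (x i)) • e i = 0 := by
      have := congrArg (Submodule.mkQ (maximalIdeal Q • (⊤ : Submodule Q N))) hx
      rw [Fintype.linearCombination_apply, map_sum, map_zero] at this
      rw [← this]
      refine Finset.sum_congr rfl fun i _ => ?_
      rw [map_smul, hv]
      rfl
    exact Ideal.Quotient.eq_zero_iff_mem.1
      (Fintype.linearIndependent_iff.1 e.linearIndependent _ h i)

/-- Functionals dual to the `v i` exist over the residue field and lift along `τ` because P is
projective. The lift `ρ₀` is only dual modulo 𝔫, but then `T` is the identity modulo 𝔫, hence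
surjective by Nakayama and so bijective. Composing with its inverse makes `ρ₀` exactly dual. -/
theorem exists_retraction_of_indepModMax {ι P : Type*} [Fintype ι] [DecidableEq ι]
    [AddCommGroup P] [Module Q P] [Module.Projective Q P] (v : ι → P)
    (hv : ∀ c : ι → Q, ∑ i, c i • v i ∈ maximalIdeal Q • (⊤ : Submodule Q P) →
      ∀ i, c i ∈ maximalIdeal Q) :
    ∃ ρ : P →ₗ[Q] (ι → Q), ∀ i, ρ (v i) = Pi.single i 1 := by
  let := Ideal.Quotient.field (maximalIdeal Q)
  let k := Q ⧸ maximalIdeal Q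
  let V := P ⧸ (maximalIdeal Q • (⊤ : Submodule Q P))
  let π : P →ₗ[Q] V := Submodule.mkQ _
  have hli : LinearIndependent k (fun i => (π (v i) : V)) := by
    rw [Fintype.linearIndependent_iff]
    intro c hc i
    choose c' hc' using fun i => Ideal.Quotient.mk_surjective (c i)
    rw [← hc', Ideal.Quotient.eq_zero_iff_mem]
    refine hv c' ?_ i
    rw [← Submodule.Quotient.mk_eq_zero, ← hc]
    change π _ = _
    rw [map_sum]
    refine Finset.sum_congr rfl fun i _ => ?_
    rw [map_smul, ← hc']
    rfl
  obtain ⟨ψ, hψ⟩ : ∃ ψ : V →ₗ[k] (ι → k), ∀ i, ψ (π (v i)) = Pi.single i 1 := by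
    obtain ⟨ψ, hψ⟩ := LinearMap.exists_leftInverse_of_injective
      (Fintype.linearCombination k fun i => (π (v i) : V))
      (LinearMap.ker_eq_bot.2 (hli.fintypeLinearCombination_injective))
    refine ⟨ψ, fun i => ?_⟩
    simpa using LinearMap.congr_fun hψ (Pi.single i 1)
  let τ : (ι → Q) →ₗ[Q] (ι → k) := LinearMap.compLeft (Submodule.mkQ (maximalIdeal Q)) ι
  have hτ : Function.Surjective τ := (Submodule.mkQ_surjective _).comp_left
  obtain ⟨ρ₀, hρ₀⟩ := Module.projective_lifting_property τ ((ψ.restrictScalars Q) ∘ₗ π) hτ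
  let T : (ι → Q) →ₗ[Q] (ι → Q) := ρ₀ ∘ₗ Fintype.linearCombination Q v
  have hT : ∀ i, T (Pi.single i 1) = ρ₀ (v i) := fun i => by simp [T]
  have hker : ∀ x, τ x = 0 → x ∈ maximalIdeal Q • (⊤ : Submodule Q (ι → Q)) := by
    intro x hx
    rw [(Pi.basisFun Q ι).mem_smul_top_iff_repr]
    intro i
    rw [Pi.basisFun_repr, ← Ideal.Quotient.eq_zero_iff_mem]
    exact congrFun hx i
  have hτT : τ ∘ₗ T = τ := by
    refine (Pi.basisFun Q ι).ext fun i => ?_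
    rw [Pi.basisFun_apply, LinearMap.comp_apply, hT]
    have h1 : τ (ρ₀ (v i)) = ψ (π (v i)) := LinearMap.congr_fun hρ₀ (v i)
    rw [h1, hψ]
    funext j
    by_cases hj : j = i
    · subst hj; simp only [Pi.single_eq_same, τ, LinearMap.compLeft_apply, Function.comp_apply]; rfl
    · simp only [Pi.single_eq_of_ne hj, τ, LinearMap.compLeft_apply, Function.comp_apply, map_zero]
  have hsurj : Function.Surjective T := by
    rw [← LinearMap.range_eq_top, ← map_mkQ_eq_top, eq_top_iff]
    rintro y -
    obtain ⟨x, rfl⟩ := Submodule.mkQ_surjective _ y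
    refine ⟨T x, ⟨_, rfl⟩, ?_⟩
    rw [← sub_eq_zero, ← map_sub, Submodule.mkQ_apply, Submodule.Quotient.mk_eq_zero]
    apply hker
    rw [map_sub, sub_eq_zero]
    exact LinearMap.congr_fun hτT x
  have hbij : Function.Bijective T :=
    ⟨OrzechProperty.injective_of_surjective_endomorphism T hsurj, hsurj⟩
  let E := LinearEquiv.ofBijective T hbij
  refine ⟨E.symm.toLinearMap ∘ₗ ρ₀, fun i => ?_⟩
  rw [LinearMap.comp_apply, LinearEquiv.coe_coe, LinearEquiv.symm_apply_eq, ← hT]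
  rfl

/-- The retraction reads off coefficients linearly, so independence modulo 𝔫 detects membership
modulo every ideal. It is used for I = 0, where it gives injectivity, and for I = 𝔫², where the
hypotheses on f and g enter. -/
theorem IndepModMaxOn.mem_of_mem_smul {κ P : Type*} [AddCommGroup P] [Module Q P]
    [Module.Projective Q P] {v : κ → P} {S : Set κ} (hv : IndepModMaxOn Q v S) (I : Ideal Q)
    {c : κ →₀ Q} (hc : c ∈ Finsupp.supported Q Q S)
    (h : Finsupp.linearCombination Q v c ∈ I • (⊤ : Submodule Q P)) (i : κ) : c i ∈ I := by
  classical
  obtain ⟨ρ, hρ⟩ := exists_retraction_of_indepModMax (Q := Q) (fun i : c.support => v i) (by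
    intro a ha j
    -- Extension of `a` by zero outside the finite support of `c`, to which the retraction lemma is
    -- restricted.
    let a' : κ →₀ Q := Finsupp.onFinset c.support
      (fun i => if hi : i ∈ c.support then a ⟨i, hi⟩ else 0) (fun i hi => by
        by_contra h'; exact hi (dif_neg h'))
    have haj : a' j = a j := by
      change (if hi : (j : κ) ∈ c.support then a ⟨j, hi⟩ else 0) = _
      rw [dif_pos j.2]
    rw [← haj]
    refine hv a' ?_ ?_ j
    · rw [Finsupp.mem_supported] at hc ⊢
      exact (Finset.coe_subset.2 Finsupp.support_onFinset_subset).trans hc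
    · convert ha
      rw [Finsupp.linearCombination_apply,
        Finsupp.sum_of_support_subset _ Finsupp.support_onFinset_subset _ (by simp),
        ← Finset.sum_coe_sort]
      refine Finset.sum_congr rfl fun i _ => ?_
      congr 1
      change (if hi : (i : κ) ∈ c.support then a ⟨i, hi⟩ else 0) = _
      rw [dif_pos i.2])
  by_cases hi : i ∈ c.support
  · have h2 : ρ (Finsupp.linearCombination Q v c) ∈ I • (⊤ : Submodule Q (c.support → Q)) := by
      have := Submodule.mem_map_of_mem (f := ρ) h
      rw [Submodule.map_smul''] at this
      exact Submodule.smul_mono le_rfl le_top this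
    rw [(Pi.basisFun Q _).mem_smul_top_iff_repr] at h2
    have h3 := h2 ⟨i, hi⟩
    rw [Pi.basisFun_repr, Finsupp.linearCombination_apply, Finsupp.sum, ← Finset.sum_coe_sort,
      map_sum, Finset.sum_apply] at h3
    simpa [hρ, Pi.single_apply] using h3
  · rw [Finsupp.notMem_support_iff.1 hi]; exact I.zero_mem

/-- The retraction splits P as Q^ι ⊕ K with K finitely generated projective, hence free over the
local ring. The splitting also shows that the subtraction of ranks is not truncated. -/
theorem exists_basis_sum_of_indepModMax {ι P : Type*} [Fintype ι]
    [AddCommGroup P] [Module Q P] [Module.Free Q P] [Module.Finite Q P] (v : ι → P)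
    (hv : ∀ c : ι → Q, ∑ i, c i • v i ∈ maximalIdeal Q • (⊤ : Submodule Q P) →
      ∀ i, c i ∈ maximalIdeal Q) :
    ∃ b : Module.Basis (ι ⊕ Fin (Module.finrank Q P - Fintype.card ι)) Q P,
      ∀ i, b (Sum.inl i) = v i := by
  classical
  obtain ⟨ρ, hρ⟩ := exists_retraction_of_indepModMax v hv
  let K := LinearMap.ker ρ
  have hρv : ∀ c, ρ (Fintype.linearCombination Q v c) = c := by
    intro c
    rw [Fintype.linearCombination_apply, map_sum]
    simp only [map_smul, hρ]
    funext j
    simp [Finset.sum_apply, Pi.single_apply]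
  let L : ((ι → Q) × K) →ₗ[Q] P := (Fintype.linearCombination Q v).coprod K.subtype
  have hL : Function.Bijective L := by
    constructor
    · rw [injective_iff_map_eq_zero]
      rintro ⟨c, x⟩ h
      have h1 : Fintype.linearCombination Q v c + x = 0 := h
      have h2 : c = 0 := by
        have := congrArg ρ h1
        rwa [map_add, hρv, LinearMap.mem_ker.1 x.2, add_zero, map_zero] at this
      subst h2
      rw [map_zero, zero_add] at h1
      exact Prod.ext rfl (Subtype.ext h1)
    · intro p
      refine ⟨⟨ρ p, ⟨p - Fintype.linearCombination Q v (ρ p), ?_⟩⟩, ?_⟩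
      · rw [LinearMap.mem_ker, map_sub, hρv, sub_self]
      · change Fintype.linearCombination Q v (ρ p) + (p - Fintype.linearCombination Q v (ρ p)) = p
        abel
  let E := LinearEquiv.ofBijective L hL
  let pr : P →ₗ[Q] K := LinearMap.snd Q (ι → Q) K ∘ₗ E.symm.toLinearMap
  have hpr : pr ∘ₗ K.subtype = LinearMap.id := by
    ext x
    have : E.symm x = (0, x) := by
      rw [LinearEquiv.symm_apply_eq]
      change (x : P) = Fintype.linearCombination Q v 0 + x
      rw [map_zero, zero_add]
    simp [pr, this]
  have : Module.Projective Q K := Module.Projective.of_split K.subtype pr hpr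
  have : Module.Finite Q K := Module.Finite.of_surjective pr (fun x => ⟨x, LinearMap.congr_fun hpr x⟩)
  have : Module.Free Q K := Module.free_of_flat_of_isLocalRing
  have hrank : Module.finrank Q K = Module.finrank Q P - Fintype.card ι := by
    rw [← E.finrank_eq, Module.finrank_prod, Module.finrank_fintype_fun_eq_card]; omega
  let bK := (Module.finBasis Q K).reindex (finCongr hrank)
  refine ⟨((Pi.basisFun Q ι).prod bK).map E, fun i => ?_⟩
  rw [Module.Basis.map_apply, Module.Basis.prod_apply]
  change L _ = _
  simp [L]

end LocalAlgebra

/-! ### Homogeneous components and homogeneous bases. -/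

namespace GradedComplex

section Graded

variable {Q : Type u} [CommRing Q] (U : GradedComplex Q)

theorem proj_mem (m : ℕ) (u : U) : U.proj m u ∈ U.deg m := by
  simp only [proj, LinearMap.comp_apply]
  exact Subtype.property _

/-- The projection of `U` to its component of degree `m`, as a map to that component. -/
noncomputable def projDeg (m : ℕ) : U →ₗ[Q] U.deg m := (U.proj m).codRestrict _ (U.proj_mem m)

/-- Each component is a direct summand, so its intersection with IU is I times the component. -/
theorem mem_smul_top_deg (I : Ideal Q) {m : ℕ} (u : U.deg m)
    (hu : (u : U) ∈ I • (⊤ : Submodule Q U)) : u ∈ I • (⊤ : Submodule Q (U.deg m)) := by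
  have h := Submodule.mem_map_of_mem (f := U.projDeg m) hu
  rw [Submodule.map_smul''] at h
  have h1 : U.projDeg m u = u := Subtype.ext (by
    change U.proj m u = u
    rw [U.proj_of_mem u.2, if_pos rfl])
  rw [h1] at h
  exact Submodule.smul_mono le_rfl le_top h

theorem coe_mem_smul_top (I : Ideal Q) {m : ℕ} (u : U.deg m)
    (hu : u ∈ I • (⊤ : Submodule Q (U.deg m))) : (u : U) ∈ I • (⊤ : Submodule Q U) := by
  have h := Submodule.mem_map_of_mem (f := (U.deg m).subtype) hu
  rw [Submodule.map_smul''] at h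
  exact Submodule.smul_mono le_rfl le_top h

theorem proj_mem_smul_top (I : Ideal Q) (m : ℕ) {u : U} (hu : u ∈ I • (⊤ : Submodule Q U)) :
    U.proj m u ∈ I • (⊤ : Submodule Q U) := by
  have h := Submodule.mem_map_of_mem (f := U.proj m) hu
  rw [Submodule.map_smul''] at h
  exact Submodule.smul_mono le_rfl le_top h

theorem d_proj_succ (n : ℕ) (u : U) : U.d (U.proj (n + 1) u) = U.proj n (U.d u) := by
  induction u using induction_deg with
  | hadd u v hu hv => simp only [map_add, hu, hv]
  | hdeg k u hu =>
    rw [U.proj_of_mem hu]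
    match k with
    | 0 => rw [U.d_deg_zero u hu, map_zero, if_neg (by omega), map_zero]
    | k + 1 =>
      rw [U.proj_of_mem (U.d_deg_succ k u hu)]
      by_cases hk : k = n
      · rw [if_pos hk, if_pos (by omega)]
      · rw [if_neg hk, if_neg (by omega), map_zero]

theorem free_carrier (h : ∀ n, Module.Free Q (U.deg n)) : Module.Free Q U :=
  Module.Free.of_equiv
    (LinearEquiv.ofBijective (DirectSum.coeLinearMap U.deg) U.bijective_coeLinearMap)

variable {U}

section HomogeneousBasis

variable {κ : Type*} (b : Module.Basis κ Q U) (δ : κ → ℕ) (hb : ∀ p, b p ∈ U.deg (δ p))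
include hb

theorem repr_proj (n : ℕ) (u : U) (p : κ) :
    b.repr (U.proj n u) p = if δ p = n then b.repr u p else 0 := by
  have h : Finsupp.lapply p ∘ₗ b.repr.toLinearMap ∘ₗ U.proj n =
      (if δ p = n then (Finsupp.lapply p ∘ₗ b.repr.toLinearMap) else 0) := by
    refine b.ext fun q => ?_
    rw [LinearMap.comp_apply, LinearMap.comp_apply, U.proj_of_mem (hb q)]
    by_cases hq : q = p
    · subst hq; split_ifs <;> simp
    · split_ifs <;> simp [Finsupp.single_eq_of_ne' hq]
  have h' := LinearMap.congr_fun h u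
  split_ifs at h' ⊢ <;> exact h'

theorem mem_deg_iff_repr (n : ℕ) (u : U) :
    u ∈ U.deg n ↔ ∀ p, b.repr u p ≠ 0 → δ p = n := by
  constructor
  · intro hu p hp
    have h := repr_proj b δ hb n u p
    rw [U.proj_of_mem hu, if_pos rfl] at h
    by_contra h'
    rw [if_neg h'] at h
    exact hp h
  · intro h
    rw [← b.linearCombination_repr u, Finsupp.linearCombination_apply]
    refine Submodule.sum_mem _ fun p hp => Submodule.smul_mem _ _ ?_
    have := hb p
    rwa [h p (Finsupp.mem_support_iff.1 hp)] at this

theorem nonempty_basis_deg (n : ℕ) :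
    Nonempty (Module.Basis {p // δ p = n} Q (U.deg n)) := by
  have hli : LinearIndependent Q (fun p : {p // δ p = n} => b p) :=
    b.linearIndependent.comp _ Subtype.val_injective
  refine ⟨(Module.Basis.span hli).map (LinearEquiv.ofEq _ _ ?_)⟩
  apply le_antisymm
  · rw [Submodule.span_le]
    rintro _ ⟨⟨p, rfl⟩, rfl⟩
    exact hb p
  · intro u hu
    rw [← b.linearCombination_repr u, Finsupp.linearCombination_apply]
    refine Submodule.sum_mem _ fun p hp => Submodule.smul_mem _ _ (Submodule.subset_span ?_)
    exact ⟨⟨p, (mem_deg_iff_repr b δ hb n u).1 hu p (Finsupp.mem_support_iff.1 hp)⟩, rfl⟩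

theorem finrank_deg [Nontrivial Q] (n : ℕ) :
    Module.finrank Q (U.deg n) = Nat.card {p // δ p = n} := by
  obtain ⟨e⟩ := nonempty_basis_deg b δ hb n
  exact Module.finrank_eq_nat_card_basis e

theorem free_deg (n : ℕ) : Module.Free Q (U.deg n) := by
  obtain ⟨e⟩ := nonempty_basis_deg b δ hb n
  exact Module.Free.of_basis e

end HomogeneousBasis

end Graded

/-! ### Existence and uniqueness of minimal free resolutions. -/

section Resolution

open IsLocalRing

variable {Q : Type u} [CommRing Q] [IsLocalRing Q]

namespace IsMinimalFreeResolution

variable {U : GradedComplex Q} {M : Type u} [AddCommGroup M] [Module Q M] {ε : U →ₗ[Q] M}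

theorem d_mem_mul_smul (h : U.IsMinimalFreeResolution ε) (I : Ideal Q) {u : U}
    (hu : u ∈ I • (⊤ : Submodule Q U)) : U.d u ∈ (I * maximalIdeal Q) • (⊤ : Submodule Q U) := by
  rw [Submodule.mul_smul]
  induction hu using Submodule.smul_induction_on' with
  | smul r hr u _ =>
    rw [map_smul]
    exact Submodule.smul_mem_smul hr (h.minimal u)
  | add x _ y _ hx hy => rw [map_add]; exact add_mem hx hy

theorem exists_d_eq (h : U.IsMinimalFreeResolution ε) {n : ℕ} {u : U} (hu : u ∈ U.deg n)
    (hd : U.d u = 0) (h0 : n = 0 → ε u = 0) : ∃ v ∈ U.deg (n + 1), U.d v = u := by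
  match n with
  | 0 => exact (h.exact_zero u hu).1 (h0 rfl)
  | n + 1 => exact (h.exact_succ n u hu).1 hd

end IsMinimalFreeResolution

/-- The cycles of degree `n` of the complex `U` augmented by `ε`. -/
def cycles (U : GradedComplex Q) {M : Type u} [AddCommGroup M] [Module Q M] (ε : U →ₗ[Q] M) :
    (n : ℕ) → Submodule Q (U.deg n)
  | 0 => LinearMap.ker (ε.domRestrict (U.deg 0))
  | n + 1 => LinearMap.ker (U.d.domRestrict (U.deg (n + 1)))

namespace IsMinimalFreeResolution

variable {U : GradedComplex Q} {M : Type u} [AddCommGroup M] [Module Q M] {ε : U →ₗ[Q] M}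

theorem mem_cycles_iff (h : U.IsMinimalFreeResolution ε) {n : ℕ} (u : U.deg n) :
    u ∈ U.cycles ε n ↔ ∃ v ∈ U.deg (n + 1), U.d v = u := by
  match n with
  | 0 => exact h.exact_zero u u.2
  | n + 1 => exact h.exact_succ n u u.2

theorem cycles_le (h : U.IsMinimalFreeResolution ε) (n : ℕ) :
    U.cycles ε n ≤ maximalIdeal Q • (⊤ : Submodule Q (U.deg n)) := by
  intro u hu
  obtain ⟨v, -, hv⟩ := (h.mem_cycles_iff u).1 hu
  refine U.mem_smul_top_deg _ u ?_
  rw [← hv]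
  exact h.minimal v

theorem surjective_domRestrict (h : U.IsMinimalFreeResolution ε) :
    Function.Surjective (ε.domRestrict (U.deg 0)) := by
  intro m
  obtain ⟨v, rfl⟩ := h.ε_surjective m
  induction v using induction_deg with
  | hadd v w hv hw =>
    obtain ⟨a, ha⟩ := hv
    obtain ⟨b, hb⟩ := hw
    exact ⟨a + b, by rw [map_add, map_add, ha, hb]⟩
  | hdeg n v hv =>
    match n with
    | 0 => exact ⟨⟨v, hv⟩, rfl⟩
    | n + 1 => exact ⟨0, by rw [map_zero, h.ε_deg_succ n v hv]⟩

theorem exists_toCycles (h : U.IsMinimalFreeResolution ε) (n : ℕ) :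
    ∃ p : U.deg (n + 1) →ₗ[Q] U.cycles ε n, Function.Surjective p ∧
      LinearMap.ker p = U.cycles ε (n + 1) := by
  let d₀ : U.deg (n + 1) →ₗ[Q] U.deg n := U.d.restrict fun u hu => U.d_deg_succ n u hu
  refine ⟨d₀.codRestrict _ fun v => (h.mem_cycles_iff _).2 ⟨v, v.2, rfl⟩, ?_, ?_⟩
  · rintro ⟨u, hu⟩
    obtain ⟨v, hv, hvu⟩ := (h.mem_cycles_iff u).1 hu
    exact ⟨⟨v, hv⟩, Subtype.ext (Subtype.ext hvu)⟩
  · ext v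
    rw [LinearMap.ker_codRestrict]
    change d₀ v = 0 ↔ U.d v = 0
    rw [Subtype.ext_iff]
    rfl

end IsMinimalFreeResolution

/-- Lift `e` and its inverse through the two covers. Both composites agree with the identity modulo
the kernels, hence modulo 𝔫, so Nakayama makes both lifts surjective, and a surjective endomorphism
of a finitely generated module is injective. -/
theorem exists_linearEquiv_of_minimal_covers {P P' N N' : Type*} [AddCommGroup P] [Module Q P]
    [AddCommGroup P'] [Module Q P'] [AddCommGroup N] [Module Q N] [AddCommGroup N'] [Module Q N']
    [Module.Free Q P] [Module.Finite Q P] [Module.Free Q P'] [Module.Finite Q P']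
    (e : N ≃ₗ[Q] N') (p : P →ₗ[Q] N) (p' : P' →ₗ[Q] N') (hp : Function.Surjective p)
    (hp' : Function.Surjective p') (hk : LinearMap.ker p ≤ maximalIdeal Q • ⊤)
    (hk' : LinearMap.ker p' ≤ maximalIdeal Q • ⊤) :
    ∃ φ : P ≃ₗ[Q] P', ∀ x, p' (φ x) = e (p x) := by
  obtain ⟨φ, hφ⟩ := Module.projective_lifting_property p' (e.toLinearMap ∘ₗ p) hp'
  obtain ⟨ψ, hψ⟩ := Module.projective_lifting_property p (e.symm.toLinearMap ∘ₗ p') hp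
  replace hφ : ∀ x, p' (φ x) = e (p x) := LinearMap.congr_fun hφ
  replace hψ : ∀ x, p (ψ x) = e.symm (p' x) := LinearMap.congr_fun hψ
  have h1 : Function.Surjective φ := by
    rw [← LinearMap.range_eq_top, ← map_mkQ_eq_top, eq_top_iff]
    rintro y -
    obtain ⟨y, rfl⟩ := Submodule.mkQ_surjective _ y
    refine ⟨φ (ψ y), ⟨_, rfl⟩, ?_⟩
    rw [← sub_eq_zero, ← map_sub, Submodule.mkQ_apply, Submodule.Quotient.mk_eq_zero]
    apply hk'
    rw [LinearMap.mem_ker, map_sub, hφ, hψ, LinearEquiv.apply_symm_apply, sub_self]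
  have h2 : Function.Surjective ψ := by
    rw [← LinearMap.range_eq_top, ← map_mkQ_eq_top, eq_top_iff]
    rintro y -
    obtain ⟨y, rfl⟩ := Submodule.mkQ_surjective _ y
    refine ⟨ψ (φ y), ⟨_, rfl⟩, ?_⟩
    rw [← sub_eq_zero, ← map_sub, Submodule.mkQ_apply, Submodule.Quotient.mk_eq_zero]
    apply hk
    rw [LinearMap.mem_ker, map_sub, hψ, hφ, LinearEquiv.symm_apply_apply, sub_self]
  have h3 : Function.Injective (ψ ∘ₗ φ) :=
    OrzechProperty.injective_of_surjective_endomorphism _ (h2.comp h1)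
  exact ⟨LinearEquiv.ofBijective φ ⟨Function.Injective.of_comp h3, h1⟩, hφ⟩

/-- Compatibility with cycles is what the induction needs: it identifies the n-th cycle modules, of
which the components of degree n + 1 are minimal covers. No chain map has to be assembled. -/
theorem IsMinimalFreeResolution.exists_linearEquiv {U U' : GradedComplex Q} {M : Type u}
    [AddCommGroup M] [Module Q M] {ε : U →ₗ[Q] M} {ε' : U' →ₗ[Q] M}
    (h : U.IsMinimalFreeResolution ε) (h' : U'.IsMinimalFreeResolution ε') (n : ℕ) :
    ∃ φ : U.deg n ≃ₗ[Q] U'.deg n, ∀ u, u ∈ U.cycles ε n ↔ φ u ∈ U'.cycles ε' n := by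
  have := h.free
  have := h.finite
  have := h'.free
  have := h'.finite
  induction n with
  | zero =>
    obtain ⟨φ, hφ⟩ := exists_linearEquiv_of_minimal_covers (LinearEquiv.refl Q M)
      _ _ h.surjective_domRestrict h'.surjective_domRestrict (h.cycles_le 0) (h'.cycles_le 0)
    refine ⟨φ, fun u => ?_⟩
    change ε.domRestrict (U.deg 0) u = 0 ↔ ε'.domRestrict (U'.deg 0) (φ u) = 0
    rw [hφ]; rfl
  | succ n ih =>
    obtain ⟨φ, hφ⟩ := ih
    obtain ⟨p, hp, hpk⟩ := h.exists_toCycles n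
    obtain ⟨p', hp', hpk'⟩ := h'.exists_toCycles n
    let e : U.cycles ε n ≃ₗ[Q] U'.cycles ε' n := φ.ofSubmodules _ _ (by
      ext u
      rw [Submodule.mem_map_equiv, hφ, LinearEquiv.apply_symm_apply])
    obtain ⟨χ, hχ⟩ := exists_linearEquiv_of_minimal_covers e p p' hp hp'
      (hpk.le.trans (h.cycles_le _)) (hpk'.le.trans (h'.cycles_le _))
    refine ⟨χ, fun u => ?_⟩
    rw [← hpk, ← hpk', LinearMap.mem_ker, LinearMap.mem_ker, hχ, LinearEquiv.map_eq_zero_iff]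

/-- Makes the chosen resolution in `bettiNumber` irrelevant: any minimal free resolution may be used
to compute it. -/
theorem IsMinimalFreeResolution.bettiNumber_eq {U : GradedComplex Q} {M : Type u}
    [AddCommGroup M] [Module Q M] {ε : U →ₗ[Q] M} (h : U.IsMinimalFreeResolution ε) (n : ℕ) :
    bettiNumber Q M n = Module.finrank Q (U.deg n) := by
  have hex : ∃ (F : GradedComplex Q) (ε : F →ₗ[Q] M), F.IsMinimalFreeResolution ε := ⟨U, ε, h⟩
  rw [bettiNumber, dif_pos hex]
  obtain ⟨φ, -⟩ := hex.choose_spec.choose_spec.exists_linearEquiv h n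
  exact φ.finrank_eq

theorem isInternal_range_lof {R : Type*} [CommRing R] (N : ℕ → Type*) [∀ n, AddCommGroup (N n)]
    [∀ n, Module R (N n)] :
    DirectSum.IsInternal fun n => LinearMap.range (DirectSum.lof R ℕ N n) := by
  refine DirectSum.isInternal_submodule_of_iSupIndep_of_iSup_eq_top ?_ ?_
  · rw [iSupIndep_def]
    intro m
    rw [Submodule.disjoint_def]
    rintro _ ⟨x, rfl⟩ hx
    have h2 : (⨆ j, ⨆ (_ : j ≠ m), LinearMap.range (DirectSum.lof R ℕ N j)) ≤
        LinearMap.ker (DirectSum.component R ℕ N m) :=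
      iSup₂_le fun j hj => by
        rintro _ ⟨y, rfl⟩
        rw [LinearMap.mem_ker, DirectSum.component.of, dif_neg hj]
    have h3 := h2 hx
    rw [LinearMap.mem_ker, DirectSum.component.lof_self] at h3
    rw [h3, map_zero]
  · rw [eq_top_iff]
    rintro x -
    induction x using DirectSum.induction_on with
    | zero => exact zero_mem _
    | of n x => exact Submodule.mem_iSup_of_mem n ⟨x, rfl⟩
    | add x y hx hy => exact add_mem hx hy

/-- The complex `⋯ → N₂ → N₁ → N₀` given by a sequence of maps. -/
noncomputable def ofSequence (N : ℕ → Type u) [∀ n, AddCommGroup (N n)] [∀ n, Module Q (N n)]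
    (p : ∀ n, N (n + 1) →ₗ[Q] N n) (hp : ∀ n x, p n (p (n + 1) x) = 0) : GradedComplex Q where
  carrier := DirectSum ℕ N
  deg n := LinearMap.range (DirectSum.lof Q ℕ N n)
  isInternal := isInternal_range_lof N
  d := DirectSum.toModule Q ℕ _ fun n => match n with
    | 0 => 0
    | n + 1 => DirectSum.lof Q ℕ N n ∘ₗ p n
  d_deg_zero := by
    rintro _ ⟨x, rfl⟩
    rw [DirectSum.toModule_lof, LinearMap.zero_apply]
  d_deg_succ n := by
    rintro _ ⟨x, rfl⟩
    rw [DirectSum.toModule_lof]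
    exact ⟨p n x, rfl⟩
  d_d u := by
    induction u using DirectSum.induction_on with
    | zero => simp only [map_zero]
    | add x y hx hy => simp only [map_add, hx, hy, add_zero]
    | of n x =>
      match n with
      | 0 =>
        rw [← DirectSum.lof_eq_of Q, DirectSum.toModule_lof, LinearMap.zero_apply, map_zero]
      | 1 =>
        rw [← DirectSum.lof_eq_of Q, DirectSum.toModule_lof, LinearMap.comp_apply,
          DirectSum.toModule_lof, LinearMap.zero_apply]
      | n + 2 =>
        rw [← DirectSum.lof_eq_of Q, DirectSum.toModule_lof, LinearMap.comp_apply,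
          DirectSum.toModule_lof, LinearMap.comp_apply, hp, map_zero]

omit [IsLocalRing Q] in
theorem ofSequence_d_succ (N : ℕ → Type u) [∀ n, AddCommGroup (N n)] [∀ n, Module Q (N n)]
    (p : ∀ n, N (n + 1) →ₗ[Q] N n) (hp : ∀ n x, p n (p (n + 1) x) = 0) (n : ℕ) (x : N (n + 1)) :
    (ofSequence N p hp).d (DirectSum.lof Q ℕ N (n + 1) x) = DirectSum.lof Q ℕ N n (p n x) :=
  DirectSum.toModule_lof Q (N := DirectSum ℕ N) (n + 1) x

theorem ofSequence_isMinimalFreeResolution (N : ℕ → Type u) [∀ n, AddCommGroup (N n)]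
    [∀ n, Module Q (N n)] [∀ n, Module.Free Q (N n)] [∀ n, Module.Finite Q (N n)]
    (p : ∀ n, N (n + 1) →ₗ[Q] N n) {M : Type u} [AddCommGroup M] [Module Q M] (p₀ : N 0 →ₗ[Q] M)
    (hsurj : Function.Surjective p₀) (h0 : LinearMap.range (p 0) = LinearMap.ker p₀)
    (hs : ∀ n, LinearMap.range (p (n + 1)) = LinearMap.ker (p n))
    (hmin : ∀ n, LinearMap.range (p n) ≤ maximalIdeal Q • ⊤) :
    ∃ (F : GradedComplex Q) (ε : F →ₗ[Q] M), F.IsMinimalFreeResolution ε ∧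
      ∀ n, Nonempty (F.deg n ≃ₗ[Q] N n) := by
  have hp : ∀ n x, p n (p (n + 1) x) = 0 := fun n x =>
    LinearMap.mem_ker.1 ((hs n).le ⟨x, rfl⟩)
  have inj : ∀ n, Function.Injective (DirectSum.lof Q ℕ N n) := DirectSum.of_injective
  let F := ofSequence N p hp
  let ε : F →ₗ[Q] M := DirectSum.toModule Q ℕ M fun n => match n with
    | 0 => p₀
    | n + 1 => 0
  have ε0 : ∀ x, ε (DirectSum.lof Q ℕ N 0 x) = p₀ x := fun x => DirectSum.toModule_lof ..
  have e : ∀ n, N n ≃ₗ[Q] F.deg n := fun n => LinearEquiv.ofInjective _ (inj n)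
  refine ⟨F, ε, ⟨?_, ?_, ?_, ?_, ?_, ?_, ?_⟩, fun n => ⟨(e n).symm⟩⟩
  · exact fun n => Module.Free.of_equiv (e n)
  · exact fun n => Module.Finite.equiv (e n)
  · rintro n _ ⟨x, rfl⟩
    exact DirectSum.toModule_lof ..
  · intro m
    obtain ⟨x, rfl⟩ := hsurj m
    exact ⟨_, ε0 x⟩
  · rintro _ ⟨x, rfl⟩
    rw [ε0, ← LinearMap.mem_ker, ← h0]
    constructor
    · rintro ⟨y, rfl⟩
      exact ⟨_, ⟨y, rfl⟩, ofSequence_d_succ ..⟩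
    · rintro ⟨_, ⟨y, rfl⟩, h⟩
      exact ⟨y, inj 0 ((ofSequence_d_succ N p hp 0 y).symm.trans h)⟩
  · rintro n _ ⟨x, rfl⟩
    have : F.d (DirectSum.lof Q ℕ N (n + 1) x) = 0 ↔ p n x = 0 := by
      rw [ofSequence_d_succ N p hp n x]
      exact map_eq_zero_iff _ (inj n)
    rw [this, ← LinearMap.mem_ker, ← hs]
    constructor
    · rintro ⟨y, rfl⟩
      exact ⟨_, ⟨y, rfl⟩, ofSequence_d_succ ..⟩
    · rintro ⟨_, ⟨y, rfl⟩, h⟩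
      exact ⟨y, inj _ ((ofSequence_d_succ N p hp _ y).symm.trans h)⟩
  · intro u
    induction u using induction_deg with
    | hadd x y hx hy => rw [map_add]; exact add_mem hx hy
    | hdeg n u hu =>
      match n with
      | 0 => rw [F.d_deg_zero u hu]; exact zero_mem _
      | n + 1 =>
        obtain ⟨x, rfl⟩ := hu
        have h := Submodule.mem_map_of_mem (f := DirectSum.lof Q ℕ N n) (hmin n ⟨x, rfl⟩)
        rw [Submodule.map_smul''] at h
        have h' := Submodule.smul_mono (le_refl (maximalIdeal Q)) le_top h
        rw [← ofSequence_d_succ N p hp n x] at h'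
        exact h'

theorem exists_isMinimalFreeResolution [IsNoetherianRing Q] (M : Type u) [AddCommGroup M]
    [Module Q M] [Module.Finite Q M] :
    ∃ (F : GradedComplex Q) (ε : F →ₗ[Q] M), F.IsMinimalFreeResolution ε := by
  obtain ⟨b₀, p₀, hp₀, hk₀⟩ := exists_surjective_of_fin_ker_le (Q := Q) M
  have step : ∀ s : (Σ b : ℕ, Submodule Q (Fin b → Q)), ∃ (b : ℕ) (p : (Fin b → Q) →ₗ[Q] (Fin s.1 → Q)),
      LinearMap.range p = s.2 ∧ LinearMap.ker p ≤ maximalIdeal Q • ⊤ := by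
    intro s
    obtain ⟨b, p, hp, hk⟩ := exists_surjective_of_fin_ker_le (Q := Q) s.2
    refine ⟨b, s.2.subtype ∘ₗ p, ?_, ?_⟩
    · rw [LinearMap.range_comp, LinearMap.range_eq_top.2 hp, Submodule.map_top,
        Submodule.range_subtype]
    · intro x hx
      rw [(Pi.basisFun Q _).mem_smul_top_iff_repr]
      exact hk x (Subtype.ext hx)
  choose b p hr hk using step
  -- The state consists of the current rank and the kernel inside that free module, which is the
  -- syzygy to be covered next.
  let s : ℕ → (Σ b : ℕ, Submodule Q (Fin b → Q)) := fun n =>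
    Nat.rec ⟨b₀, LinearMap.ker p₀⟩ (fun _ s => ⟨b s, LinearMap.ker (p s)⟩) n
  have hs : ∀ n, (s n).2 ≤ maximalIdeal Q • ⊤ := by
    intro n
    cases n with
    | zero =>
      intro x hx
      rw [(Pi.basisFun Q _).mem_smul_top_iff_repr]
      exact hk₀ x hx
    | succ n => exact hk (s n)
  obtain ⟨F, ε, h, -⟩ := ofSequence_isMinimalFreeResolution (fun n => Fin (s n).1 → Q)
    (fun n => p (s n)) p₀ hp₀ (hr (s 0)) (fun n => hr (s (n + 1)))
    (fun n => (hr (s n)).le.trans (hs n))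
  exact ⟨F, ε, h⟩

end Resolution

end GradedComplex

/-! ### Free modules over the Tate construction and their derivations. -/

namespace TateAlgebra

variable {Q : Type u} [CommRing Q] (f g : Q)

theorem y_mem_deg (n : ℕ) : y f g n ∈ deg f g n := Submodule.mem_span_singleton_self _

variable {f g} in
theorem mul_mem_deg {i j : ℕ} {a b : TateAlgebra f g} (ha : a ∈ deg f g i) (hb : b ∈ deg f g j) :
    a * b ∈ deg f g (i + j) := by
  obtain ⟨r, rfl⟩ := Submodule.mem_span_singleton.1 ha
  obtain ⟨s, rfl⟩ := Submodule.mem_span_singleton.1 hb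
  rw [smul_mul_smul_comm, y_mul_y, smul_smul]
  exact Submodule.smul_mem _ _ (y_mem_deg f g _)

theorem coeff_mul_coeff (hfg : f * g = 0) (n : ℕ) : coeff f g (n + 1) * coeff f g n = 0 := by
  unfold coeff
  rcases Nat.mod_two_eq_zero_or_one n with h | h
  · rw [if_pos (by omega), if_neg (by omega), hfg]
  · rw [if_neg (by omega), if_pos (by omega), mul_comm, hfg]

theorem repr_d (a : TateAlgebra f g) (n : ℕ) :
    (basis f g).repr (d f g a) n = coeff f g (n + 1) * (basis f g).repr a (n + 1) := by
  induction a using basis_induction with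
  | h0 => simp
  | hadd a b ha hb => simp only [map_add, Finsupp.add_apply, ha, hb, mul_add]
  | hsmul r a ha => simp only [map_smul, Finsupp.smul_apply, ha, smul_eq_mul]; ring
  | hy k =>
    match k with
    | 0 => rw [d_y_zero]; simp
    | k + 1 =>
      rw [d_y_succ]
      by_cases hk : k = n
      · subst hk; simp
      · have h2 : k + 1 ≠ n + 1 := by omega
        simp [Finsupp.single_eq_of_ne' hk, Finsupp.single_eq_of_ne' h2]

section Free

variable {Λ : Type*}

variable (Λ) in
/-- The `Q`-basis `yₙ e_l` of the free module on the symbols `e_l` over the Tate construction. -/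
noncomputable def freeBasis : Module.Basis (Σ _ : Λ, ℕ) Q (Λ →₀ TateAlgebra f g) :=
  Finsupp.basis fun _ => basis f g

theorem freeBasis_apply (p : Σ _ : Λ, ℕ) :
    freeBasis f g Λ p = Finsupp.single p.1 (y f g p.2) := by
  rw [freeBasis, Finsupp.coe_basis]

theorem freeBasis_repr (x : Λ →₀ TateAlgebra f g) (p : Σ _ : Λ, ℕ) :
    (freeBasis f g Λ).repr x p = (basis f g).repr (x p.1) p.2 := rfl

theorem y_smul_freeBasis (n : ℕ) (p : Σ _ : Λ, ℕ) :
    y f g n • freeBasis f g Λ p = (α n p.2 : Q) • freeBasis f g Λ ⟨p.1, n + p.2⟩ := by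
  rw [freeBasis_apply, freeBasis_apply, Finsupp.smul_single, smul_eq_mul, y_mul_y,
    Finsupp.smul_single]

variable {f g}

/-- The derivation of the free module on the symbols `e_l` that maps `e_l` to `δ l`. -/
noncomputable def freeD (δ : Λ → Λ →₀ TateAlgebra f g) :
    (Λ →₀ TateAlgebra f g) →ₗ[Q] (Λ →₀ TateAlgebra f g) :=
  (freeBasis f g Λ).constr Q fun p =>
    Finsupp.single p.1 (d f g (y f g p.2)) + (-1 : ℤ) ^ p.2 • (y f g p.2 • δ p.1)

theorem freeD_freeBasis (δ : Λ → Λ →₀ TateAlgebra f g) (p : Σ _ : Λ, ℕ) :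
    freeD δ (freeBasis f g Λ p) =
      Finsupp.single p.1 (d f g (y f g p.2)) + (-1 : ℤ) ^ p.2 • (y f g p.2 • δ p.1) :=
  (freeBasis f g Λ).constr_basis ..

theorem freeD_single (δ : Λ → Λ →₀ TateAlgebra f g) (l : Λ) {i : ℕ} {a : TateAlgebra f g}
    (ha : a ∈ deg f g i) :
    freeD δ (Finsupp.single l a) = Finsupp.single l (d f g a) + (-1 : ℤ) ^ i • (a • δ l) := by
  obtain ⟨r, rfl⟩ := Submodule.mem_span_singleton.1 ha
  rw [← Finsupp.smul_single, map_smul]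
  have := freeD_freeBasis δ ⟨l, i⟩
  rw [freeBasis_apply] at this
  rw [this, map_smul, ← Finsupp.smul_single, smul_add, smul_comm r, smul_assoc]

/-- On `Q`-basis elements this is the Leibniz rule of A. Nothing is asserted about the square of
`freeD`: the differential of interest is that of U, which squares to zero already. -/
theorem freeD_smul (δ : Λ → Λ →₀ TateAlgebra f g) {i : ℕ} {a : TateAlgebra f g}
    (ha : a ∈ deg f g i) (x : Λ →₀ TateAlgebra f g) :
    freeD δ (a • x) = d f g a • x + (-1 : ℤ) ^ i • (a • freeD δ x) := by
  have hx : x ∈ Submodule.span Q (Set.range (freeBasis f g Λ)) := by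
    rw [(freeBasis f g Λ).span_eq]; trivial
  induction hx using Submodule.span_induction with
  | zero => simp
  | add x y _ _ hx hy => simp only [smul_add, map_add, hx, hy]; abel
  | smul r x _ hx =>
    rw [smul_comm a r, map_smul, hx, map_smul, smul_add, smul_comm r, smul_comm r, smul_comm r]
  | mem x hx =>
    obtain ⟨⟨l, n⟩, rfl⟩ := hx
    rw [freeBasis_apply]
    simp only
    rw [Finsupp.smul_single, smul_eq_mul, freeD_single δ l (mul_mem_deg ha (y_mem_deg f g n)),
      freeD_single δ l (y_mem_deg f g n), leibniz f g i _ _ ha, Finsupp.single_add, smul_add,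
      smul_add, Finsupp.smul_single, Finsupp.smul_single, smul_eq_mul, smul_eq_mul, add_assoc,
      pow_add, mul_smul, mul_smul, smul_comm a ((-1 : ℤ) ^ n)]
    congr 2
    rw [Finsupp.smul_single]
    congr 1
    rw [zsmul_eq_mul]
    push_cast
    rfl

end Free

end TateAlgebra

/-! ### Transport of a semi-free structure to a complex. -/

section Transport

variable {Q : Type u} [CommRing Q] {f g : Q}

/-- The A-action is carried over along `Φ`; the Leibniz rule comes from `freeD_smul` because `Φ`
intertwines `freeD` with the given differential. -/
theorem exists_semiFree_of_linearEquiv {U : GradedComplex Q} {Λ : Type} (r : Λ → ℕ)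
    (δ : Λ → Λ →₀ TateAlgebra f g) (Φ : (Λ →₀ TateAlgebra f g) ≃ₗ[Q] U)
    (hdeg : ∀ p, Φ (TateAlgebra.freeBasis f g Λ p) ∈ U.deg (r p.1 + p.2))
    (hd : ∀ x, U.d (Φ x) = Φ (TateAlgebra.freeD δ x)) :
    ∃ (_ : Module (TateAlgebra f g) U) (_ : IsDGModule f g U), IsSemiFree f g U := by
  let inst : Module (TateAlgebra f g) U := Φ.symm.toAddEquiv.module (TateAlgebra f g)
  have smul_def : ∀ (a : TateAlgebra f g) (u : U), a • u = Φ (a • Φ.symm u) := fun _ _ => rfl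
  have tower : IsScalarTower Q (TateAlgebra f g) U := ⟨fun r a u => by
    rw [smul_def, smul_def, smul_assoc, map_smul]⟩
  refine ⟨inst, { smul_mem_deg := ?_, leibniz := ?_ }, ?_⟩
  · intro i n a u ha hu
    obtain ⟨s, rfl⟩ := Submodule.mem_span_singleton.1 ha
    rw [smul_assoc]
    refine Submodule.smul_mem _ _ ?_
    let b := (TateAlgebra.freeBasis f g Λ).map Φ
    have hb : ∀ p, b p ∈ U.deg (r p.1 + p.2) := fun p => by
      rw [Module.Basis.map_apply]; exact hdeg p
    rw [← b.linearCombination_repr u, Finsupp.linearCombination_apply, Finsupp.sum,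
      Finset.smul_sum]
    refine Submodule.sum_mem _ fun p hp => ?_
    have hpn := (GradedComplex.mem_deg_iff_repr b _ hb n u).1 hu p (Finsupp.mem_support_iff.1 hp)
    rw [smul_def, Φ.symm.map_smul, smul_comm, Φ.map_smul, Module.Basis.map_apply,
      LinearEquiv.symm_apply_apply, TateAlgebra.y_smul_freeBasis, map_smul]
    refine Submodule.smul_mem _ _ (Submodule.smul_mem _ _ ?_)
    have h := hdeg ⟨p.1, i + p.2⟩
    have e : r p.1 + (i + p.2) = i + n := by omega
    simp only [e] at h
    exact h
  · intro i a u ha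
    obtain ⟨x, rfl⟩ := Φ.surjective u
    rw [smul_def, hd, hd, smul_def, smul_def, LinearEquiv.symm_apply_apply,
      LinearEquiv.symm_apply_apply, TateAlgebra.freeD_smul δ ha, map_add, map_zsmul]
  · let E : U ≃ₗ[TateAlgebra f g] (Λ →₀ TateAlgebra f g) :=
      { Φ.symm.toAddEquiv with
        map_smul' := fun a u => by
          change Φ.symm (a • u) = a • Φ.symm u
          rw [smul_def, LinearEquiv.symm_apply_apply] }
    refine ⟨ULift Λ, (Module.Basis.ofRepr E).reindex Equiv.ulift.symm, fun l => ⟨r l.down, ?_⟩⟩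
    rw [Module.Basis.reindex_apply]
    have h := hdeg ⟨l.down, 0⟩
    rw [TateAlgebra.freeBasis_apply] at h
    exact h

end Transport

/-! ### Partial semi-free resolutions and the lifting of boundaries. -/

section Existence

open IsLocalRing TateAlgebra

variable {Q : Type u} [CommRing Q] (f g : Q) (r : ℕ → ℕ)

/-- Symbols `e_{i,l}` of degree `i`, for `l < r i`. -/
abbrev GradedSymbols (r : ℕ → ℕ) : Type := Σ i : ℕ, Fin (r i)

/-- The `Q`-linear map from the free module on the symbols to `U` given by the images `w` of the
elements `yₙ e_l`. -/
noncomputable abbrev freeMap {U : GradedComplex Q} (w : (Σ _ : GradedSymbols r, ℕ) → U) :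
    (GradedSymbols r →₀ TateAlgebra f g) →ₗ[Q] U :=
  (freeBasis f g (GradedSymbols r)).constr Q w

/-- The span of the elements `yₙ e_l` with index in `S`. -/
noncomputable abbrev freeSpan (S : Set (Σ _ : GradedSymbols r, ℕ)) :
    Submodule Q (GradedSymbols r →₀ TateAlgebra f g) :=
  Submodule.span Q (freeBasis f g (GradedSymbols r) '' S)

variable {f g r}

theorem freeMap_freeBasis {U : GradedComplex Q} (w : (Σ _ : GradedSymbols r, ℕ) → U) (p) :
    freeMap f g r w (freeBasis f g _ p) = w p := (freeBasis f g _).constr_basis ..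

theorem freeMap_apply {U : GradedComplex Q} (w : (Σ _ : GradedSymbols r, ℕ) → U) (x) :
    freeMap f g r w x = Finsupp.linearCombination Q w ((freeBasis f g _).repr x) := by
  rw [freeMap, Module.Basis.constr_apply, Finsupp.linearCombination_apply]

theorem mem_freeSpan_iff {S : Set (Σ _ : GradedSymbols r, ℕ)} {x} :
    x ∈ freeSpan f g r S ↔ (freeBasis f g _).repr x ∈ Finsupp.supported Q Q S := by
  rw [Module.Basis.mem_span_image, Finsupp.mem_supported]

theorem freeSpan_mono {S T : Set (Σ _ : GradedSymbols r, ℕ)} (h : S ⊆ T) :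
    freeSpan f g r S ≤ freeSpan f g r T := Submodule.span_mono (Set.image_mono h)

theorem freeMap_congr {U : GradedComplex Q} {w w' : (Σ _ : GradedSymbols r, ℕ) → U} {S}
    (h : ∀ p ∈ S, w p = w' p) {x} (hx : x ∈ freeSpan f g r S) :
    freeMap f g r w x = freeMap f g r w' x := by
  refine LinearMap.eqOn_span' ?_ hx
  rintro _ ⟨p, hp, rfl⟩
  rw [freeMap_freeBasis, freeMap_freeBasis, h p hp]

theorem freeD_congr {δ δ' : GradedSymbols r → GradedSymbols r →₀ TateAlgebra f g} {S}
    (h : ∀ p ∈ S, δ p.1 = δ' p.1) {x} (hx : x ∈ freeSpan f g r S) :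
    freeD δ x = freeD δ' x := by
  refine LinearMap.eqOn_span' ?_ hx
  rintro _ ⟨p, hp, rfl⟩
  rw [freeD_freeBasis, freeD_freeBasis, h p hp]

theorem y_smul_mem_freeSpan (n : ℕ) {S T : Set (Σ _ : GradedSymbols r, ℕ)}
    (hST : ∀ p ∈ S, (⟨p.1, n + p.2⟩ : Σ _ : GradedSymbols r, ℕ) ∈ T) {x}
    (hx : x ∈ freeSpan f g r S) : y f g n • x ∈ freeSpan f g r T := by
  induction hx using Submodule.span_induction with
  | zero => rw [smul_zero]; exact zero_mem _
  | add x y _ _ hx hy => rw [smul_add]; exact add_mem hx hy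
  | smul s x _ hx => rw [smul_comm]; exact Submodule.smul_mem _ _ hx
  | mem x hx =>
    obtain ⟨p, hp, rfl⟩ := hx
    rw [y_smul_freeBasis]
    exact Submodule.smul_mem _ _ (Submodule.subset_span ⟨_, hST p hp, rfl⟩)

/-- The differential of the free module takes degree `j + 1` to degree `j` and preserves the
span of the symbols of degree less than `m`. -/
theorem freeD_mem_freeSpan {δ : GradedSymbols r → GradedSymbols r →₀ TateAlgebra f g} {m : ℕ}
    (hδ : ∀ l : GradedSymbols r, l.1 < m → δ l ∈ freeSpan f g r {p | p.1.1 + p.2 + 1 = l.1})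
    {j : ℕ} {x} (hx : x ∈ freeSpan f g r {p | p.1.1 < m ∧ p.1.1 + p.2 = j}) :
    freeD δ x ∈ freeSpan f g r {p | p.1.1 < m ∧ p.1.1 + p.2 + 1 = j} := by
  induction hx using Submodule.span_induction with
  | zero => rw [map_zero]; exact zero_mem _
  | add x y _ _ hx hy => rw [map_add]; exact add_mem hx hy
  | smul s x _ hx => rw [map_smul]; exact Submodule.smul_mem _ _ hx
  | mem x hx =>
    obtain ⟨⟨l, n⟩, ⟨hl, hn⟩, rfl⟩ := hx
    simp only at hl hn
    rw [freeD_freeBasis]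
    refine add_mem ?_ (zsmul_mem ?_ _)
    · match n with
      | 0 => rw [d_y_zero, Finsupp.single_zero]; exact zero_mem _
      | n + 1 =>
        rw [d_y_succ, ← Finsupp.smul_single]
        refine Submodule.smul_mem _ _ (Submodule.subset_span ⟨⟨l, n⟩, ⟨hl, ?_⟩, ?_⟩)
        · simp only; omega
        · rw [freeBasis_apply]
    · refine y_smul_mem_freeSpan n ?_ (hδ l hl)
      rintro p hp
      simp only [Set.mem_ofPred_eq] at hp ⊢
      omega

/-- Every `δ l'` involves only symbols of degree less than m, so the coefficients on a symbol of
degree m are affected only by the differential of A. -/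
theorem repr_freeD_of_top {δ : GradedSymbols r → GradedSymbols r →₀ TateAlgebra f g} {m : ℕ}
    (hδ : ∀ l : GradedSymbols r, l.1 < m + 1 →
      δ l ∈ freeSpan f g r {p | p.1.1 + p.2 + 1 = l.1})
    {x} (hx : x ∈ freeSpan f g r {p | p.1.1 < m + 1}) (l : GradedSymbols r) (hl : l.1 = m)
    (n : ℕ) : (freeBasis f g _).repr (freeD δ x) ⟨l, n⟩ =
      coeff f g (n + 1) * (freeBasis f g _).repr x ⟨l, n + 1⟩ := by
  induction hx using Submodule.span_induction with
  | zero => simp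
  | add x y _ _ hx hy => simp only [map_add, Finsupp.add_apply, hx, hy, mul_add]
  | smul s x _ hx => simp only [map_smul, Finsupp.smul_apply, hx, smul_eq_mul]; ring
  | mem x hx =>
    obtain ⟨⟨l', k⟩, hl', rfl⟩ := hx
    simp only [Set.mem_ofPred_eq] at hl'
    have h0 : (freeBasis f g _).repr (y f g k • δ l') ⟨l, n⟩ = 0 := by
      have h1 : y f g k • δ l' ∈ freeSpan f g r {p | p.1.1 < m} := by
        refine y_smul_mem_freeSpan k ?_ (hδ l' hl')
        rintro p hp
        simp only [Set.mem_ofPred_eq] at hp ⊢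
        omega
      rw [mem_freeSpan_iff, Finsupp.mem_supported'] at h1
      refine h1 _ ?_
      simp only [Set.mem_ofPred_eq]
      omega
    rw [freeD_freeBasis, map_add, map_zsmul, Finsupp.add_apply, Finsupp.smul_apply, h0, smul_zero,
      add_zero, freeBasis_repr, freeBasis_repr, freeBasis_apply]
    simp only
    by_cases hll : l' = l
    · subst hll
      rw [Finsupp.single_eq_same, Finsupp.single_eq_same, repr_d]
    · rw [Finsupp.single_eq_of_ne' hll, Finsupp.single_eq_of_ne' hll]
      simp

theorem d_freeMap_of_mem {U : GradedComplex Q} {w : (Σ _ : GradedSymbols r, ℕ) → U}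
    {δ : GradedSymbols r → GradedSymbols r →₀ TateAlgebra f g} {S : Set (Σ _ : GradedSymbols r, ℕ)}
    (h : ∀ p ∈ S, U.d (w p) = freeMap f g r w (freeD δ (freeBasis f g _ p)))
    {x} (hx : x ∈ freeSpan f g r S) :
    U.d (freeMap f g r w x) = freeMap f g r w (freeD δ x) := by
  induction hx using Submodule.span_induction with
  | zero => simp
  | add x y _ _ hx hy => simp only [map_add, hx, hy]
  | smul s x _ hx => simp only [map_smul, hx]
  | mem x hx =>
    obtain ⟨p, hp, rfl⟩ := hx
    rw [freeMap_freeBasis, h p hp]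

/-- A semi-free dg module on the symbols of degree less than `m`, mapped to the complex `U`, which
is an isomorphism in degrees less than `m` and injective modulo the maximal ideal in all
degrees. -/
structure IsPartialResolution [IsLocalRing Q] (U : GradedComplex Q) (m : ℕ)
    (w : (Σ _ : GradedSymbols r, ℕ) → U)
    (δ : GradedSymbols r → GradedSymbols r →₀ TateAlgebra f g) : Prop where
  mem_deg : ∀ p, p.1.1 < m → w p ∈ U.deg (p.1.1 + p.2)
  δ_mem : ∀ l : GradedSymbols r, l.1 < m → δ l ∈ freeSpan f g r {p | p.1.1 + p.2 + 1 = l.1}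
  d_eq : ∀ p, p.1.1 < m → U.d (w p) = freeMap f g r w (freeD δ (freeBasis f g _ p))
  indep : IndepModMaxOn Q w {p | p.1.1 < m}
  surj : ∀ j < m, ∀ u ∈ U.deg j,
    ∃ x ∈ freeSpan f g r {p | p.1.1 + p.2 = j}, freeMap f g r w x = u

namespace IsPartialResolution

variable [IsLocalRing Q] {U : GradedComplex Q} {m : ℕ} {w : (Σ _ : GradedSymbols r, ℕ) → U}
  {δ : GradedSymbols r → GradedSymbols r →₀ TateAlgebra f g}

theorem d_freeMap (h : IsPartialResolution U m w δ) {x} (hx : x ∈ freeSpan f g r {p | p.1.1 < m}) :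
    U.d (freeMap f g r w x) = freeMap f g r w (freeD δ x) :=
  d_freeMap_of_mem h.d_eq hx

theorem freeMap_mem_deg (h : IsPartialResolution U m w δ) {j : ℕ} {x}
    (hx : x ∈ freeSpan f g r {p | p.1.1 < m ∧ p.1.1 + p.2 = j}) :
    freeMap f g r w x ∈ U.deg j := by
  induction hx using Submodule.span_induction with
  | zero => rw [map_zero]; exact zero_mem _
  | add x y _ _ hx hy => rw [map_add]; exact add_mem hx hy
  | smul s x _ hx => rw [map_smul]; exact Submodule.smul_mem _ _ hx
  | mem x hx =>
    obtain ⟨p, ⟨hp, rfl⟩, rfl⟩ := hx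
    rw [freeMap_freeBasis]
    exact h.mem_deg p hp

/-- Independence modulo 𝔫 gives genuine injectivity, by `mem_of_mem_smul` with the zero ideal. -/
theorem eq_zero_of_freeMap_eq_zero [Module.Projective Q U] (h : IsPartialResolution U m w δ) {x}
    (hx : x ∈ freeSpan f g r {p | p.1.1 < m}) (h0 : freeMap f g r w x = 0) : x = 0 := by
  rw [← (freeBasis f g _).repr.map_eq_zero_iff]
  ext p
  have := h.indep.mem_of_mem_smul ⊥ (mem_freeSpan_iff.1 hx)
    (by rw [← freeMap_apply, h0]; exact zero_mem _) p
  simpa using this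

end IsPartialResolution

/-- Here `w n` is to become yₙ e and `q n` stands for (-1)ⁿ yₙ ∂e, so the required equations are the
Leibniz rule. Each is solvable by exactness: the right-hand side is a cycle because consecutive
coefficients have product zero and the `q` satisfy the matching relation. -/
theorem GradedComplex.IsMinimalFreeResolution.exists_lift_sequence [IsLocalRing Q]
    {U : GradedComplex Q} {M : Type u} [AddCommGroup M] [Module Q M] {ε : U →ₗ[Q] M}
    (h : U.IsMinimalFreeResolution ε) (hfM : ∀ m : M, f • m = 0) (hfg : f * g = 0) (m : ℕ)
    {e : U} (he : e ∈ U.deg m) (q : ℕ → U) (hq : ∀ n, q (n + 1) ∈ U.deg (m + n))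
    (hq0 : U.d e = q 0) (hqd : ∀ n, U.d (q (n + 1)) = -(coeff f g (n + 1) • q n))
    (hqm : m = 0 → q 1 = 0) :
    ∃ w : ℕ → U, w 0 = e ∧ (∀ n, w n ∈ U.deg (m + n)) ∧
      ∀ n, U.d (w (n + 1)) = coeff f g (n + 1) • w n + q (n + 1) := by
  have step : ∀ n (u : U), u ∈ U.deg (m + n) → U.d (coeff f g (n + 1) • u + q (n + 1)) = 0 →
      (n = 0 → u = e) → ∃ v ∈ U.deg (m + (n + 1)), U.d v = coeff f g (n + 1) • u + q (n + 1) := by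
    intro n u hu hd h0
    refine h.exists_d_eq (n := m + n) (add_mem (Submodule.smul_mem _ _ hu) (hq n)) hd fun hmn => ?_
    -- In degree 0, exactness asks for vanishing under the augmentation. This is the only place in
    -- the recursion where f M = 0 is needed.
    obtain ⟨rfl, rfl⟩ : m = 0 ∧ n = 0 := by omega
    rw [hqm rfl, add_zero, map_smul]
    exact hfM _
  -- The state carries the cycle condition for the next equation, which is what keeps the recursion
  -- going.
  have step' : ∀ n, ∀ s : {u : U // u ∈ U.deg (m + n) ∧
      U.d (coeff f g (n + 1) • u + q (n + 1)) = 0 ∧ (n = 0 → u = e)},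
      ∃ t : {u : U // u ∈ U.deg (m + (n + 1)) ∧
      U.d (coeff f g (n + 1 + 1) • u + q (n + 1 + 1)) = 0 ∧ (n + 1 = 0 → u = e)},
        U.d t = coeff f g (n + 1) • s.1 + q (n + 1) := by
    rintro n ⟨u, h1, h2, h3⟩
    obtain ⟨v, hv, hvd⟩ := step n u h1 h2 h3
    refine ⟨⟨v, hv, ?_, fun h => by omega⟩, hvd⟩
    rw [map_add, map_smul, hvd, hqd, smul_add, smul_smul, coeff_mul_coeff f g hfg, zero_smul,
      zero_add, add_neg_cancel]
  choose nxt hnxt using step'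
  let s : ∀ n, {u : U // u ∈ U.deg (m + n) ∧
      U.d (coeff f g (n + 1) • u + q (n + 1)) = 0 ∧ (n = 0 → u = e)} := fun n =>
    Nat.rec ⟨e, he, by rw [map_add, map_smul, hq0, hqd, add_neg_cancel], fun _ => rfl⟩
      (fun n s => nxt n s) n
  exact ⟨fun n => (s n).1, rfl, fun n => (s n).2.1, fun n => hnxt n (s n)⟩

end Existence

/-! ### Adjoining the symbols of one degree. -/

section Existence

open IsLocalRing TateAlgebra

variable {Q : Type u} [CommRing Q] {f g : Q} {r : ℕ → ℕ}

/-- The indices of the basis elements of degree `m`: those on symbols of lower degree, and the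
symbols of degree `m`. -/
def degIndex (r : ℕ → ℕ) (m : ℕ) : (Σ i : Fin m, Fin (r i)) ⊕ Fin (r m) → Σ _ : GradedSymbols r, ℕ
  | .inl q => ⟨⟨q.1, q.2⟩, m - q.1⟩
  | .inr l => ⟨⟨m, l⟩, 0⟩

theorem degIndex_injective (m : ℕ) : Function.Injective (degIndex r m) := by
  rintro (⟨⟨i, hi⟩, l⟩ | l) (⟨⟨i', hi'⟩, l'⟩ | l') h <;>
    simp only [degIndex, Sigma.mk.injEq] at h
  · obtain ⟨⟨rfl, hl⟩, -⟩ := h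
    cases hl
    rfl
  · omega
  · omega
  · obtain ⟨⟨-, hl⟩, -⟩ := h
    cases hl
    rfl

theorem range_degIndex (m : ℕ) :
    Set.range (degIndex r m) = {p | p.1.1 < m + 1 ∧ p.1.1 + p.2 = m} := by
  ext ⟨⟨i, l⟩, n⟩
  simp only [Set.mem_range, Set.mem_ofPred_eq]
  constructor
  · rintro ⟨⟨⟨i', hi'⟩, l'⟩ | l', h⟩ <;> simp only [degIndex, Sigma.mk.injEq] at h
    · obtain ⟨⟨rfl, -⟩, hn⟩ := h
      have := eq_of_heq hn
      omega
    · obtain ⟨⟨rfl, -⟩, hn⟩ := h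
      have := eq_of_heq hn
      omega
  · rintro ⟨hi, hn⟩
    rcases Nat.lt_or_ge i m with h | h
    · refine ⟨Sum.inl ⟨⟨i, h⟩, l⟩, ?_⟩
      have : n = m - i := by omega
      subst this
      rfl
    · obtain rfl : i = m := by omega
      obtain rfl : n = 0 := by omega
      exact ⟨Sum.inr l, rfl⟩

variable [IsLocalRing Q]

/-- Linear independence modulo the maximal ideal of a family of homogeneous elements can be
checked in each degree. -/
theorem IndepModMaxOn.of_homogeneous {U : GradedComplex Q} {κ : Type*} {v : κ → U} {S : Set κ}
    {t : κ → ℕ} (hv : ∀ p ∈ S, v p ∈ U.deg (t p))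
    (h : ∀ j, IndepModMaxOn Q v {p | p ∈ S ∧ t p = j}) : IndepModMaxOn Q v S := by
  classical
  intro c hc hcv p
  have key : Finsupp.linearCombination Q v (c.filter fun q => t q = t p) =
      U.proj (t p) (Finsupp.linearCombination Q v c) := by
    rw [Finsupp.linearCombination_apply, Finsupp.linearCombination_apply, Finsupp.sum,
      Finsupp.sum, map_sum, Finsupp.support_filter, Finset.sum_filter]
    refine Finset.sum_congr rfl fun q hq => ?_
    rw [map_smul, U.proj_of_mem (hv q (hc hq))]
    split_ifs with h1
    · rw [Finsupp.filter_apply_pos (fun q => t q = t p) c h1]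
    · rw [smul_zero]
  have h1 := h (t p) (c.filter fun q => t q = t p) (by
    rw [Finsupp.mem_supported]
    intro q hq
    rw [Finset.mem_coe, Finsupp.support_filter, Finset.mem_filter] at hq
    exact ⟨hc hq.1, hq.2⟩) (by rw [key]; exact U.proj_mem_smul_top _ _ hcv) p
  rwa [Finsupp.filter_apply_pos (fun q => t q = t p) c rfl] at h1

namespace IsPartialResolution

variable {U : GradedComplex Q} {m : ℕ} {w : (Σ _ : GradedSymbols r, ℕ) → U}
  {δ : GradedSymbols r → GradedSymbols r →₀ TateAlgebra f g}

/-- The elements of degree m on older symbols are independent modulo 𝔫, so they extend to a basis of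
Uₘ; exactly `r m` new symbols are missing. -/
theorem exists_basis_deg (h : IsPartialResolution U m w δ) [Module.Free Q (U.deg m)]
    [Module.Finite Q (U.deg m)]
    (hr : r m = Module.finrank Q (U.deg m) - ∑ i : Fin m, r i) :
    ∃ b : Module.Basis ((Σ i : Fin m, Fin (r i)) ⊕ Fin (r m)) Q (U.deg m),
      ∀ q, (b (Sum.inl q) : U) = w (degIndex r m (Sum.inl q)) := by
  have hdeg : ∀ q : (Σ i : Fin m, Fin (r i)), w (degIndex r m (Sum.inl q)) ∈ U.deg m := by
    intro q
    have h1 := h.mem_deg (degIndex r m (Sum.inl q)) q.1.2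
    have h2 : (degIndex r m (Sum.inl q)).1.1 + (degIndex r m (Sum.inl q)).2 = m :=
      Nat.add_sub_cancel' q.1.2.le
    rwa [h2] at h1
  obtain ⟨b, hb⟩ := exists_basis_sum_of_indepModMax (Q := Q)
    (fun q => (⟨_, hdeg q⟩ : U.deg m)) (by
      intro c hc q
      have h1 := U.coe_mem_smul_top _ _ hc
      have hinj := (degIndex_injective (r := r) m).comp Sum.inl_injective
      let c' := (Finsupp.equivFunOnFinite.symm c).mapDomain (degIndex r m ∘ Sum.inl)
      have h2 := h.indep c' (by
        rw [Finsupp.mem_supported]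
        intro p hp
        obtain ⟨q, -, rfl⟩ := Finset.mem_image.1 (Finsupp.mapDomain_support hp)
        exact q.1.2) (by
        rw [Finsupp.linearCombination_mapDomain, Finsupp.linearCombination_apply,
          Finsupp.sum_fintype _ _ (by simp)]
        convert h1
        simp) (degIndex r m (Sum.inl q))
      have h3 : c' (degIndex r m (Sum.inl q)) = c q :=
        Finsupp.mapDomain_apply hinj _ q
      rwa [h3] at h2)
  have hcard : Module.finrank Q (U.deg m) - Fintype.card (Σ i : Fin m, Fin (r i)) = r m := by
    rw [hr, Fintype.card_sigma]
    simp
  refine ⟨b.reindex ((Equiv.refl _).sumCongr (finCongr hcard)), fun q => ?_⟩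
  rw [Module.Basis.reindex_apply]
  exact congrArg Subtype.val (hb q)

theorem exists_lift (h : IsPartialResolution U m w δ) {u : U} (hu : u ∈ U.deg m) :
    ∃ x ∈ freeSpan f g r {p | p.1.1 + p.2 + 1 = m}, freeMap f g r w x = U.d u := by
  match m with
  | 0 => exact ⟨0, zero_mem _, by rw [map_zero, U.d_deg_zero u hu]⟩
  | m + 1 =>
    obtain ⟨x, hx, hxu⟩ := h.surj m (Nat.lt_succ_self m) _ (U.d_deg_succ m u hu)
    refine ⟨x, freeSpan_mono ?_ hx, hxu⟩
    intro p hp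
    simp only [Set.mem_ofPred_eq] at hp ⊢
    omega

/-- A new symbol needs a boundary `x` in the module built so far and images `v n` for all its
multiples by yₙ. The former comes from surjectivity in degree m - 1, the latter from
`exists_lift_sequence`. -/
theorem exists_symbol {M : Type u} [AddCommGroup M] [Module Q M] {ε : U →ₗ[Q] M}
    (hU : U.IsMinimalFreeResolution ε) (hfM : ∀ m : M, f • m = 0) (hfg : f * g = 0)
    (h : IsPartialResolution U m w δ) {e : U} (he : e ∈ U.deg m) :
    ∃ x ∈ freeSpan f g r {p | p.1.1 + p.2 + 1 = m}, ∃ v : ℕ → U, v 0 = e ∧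
      (∀ n, v n ∈ U.deg (m + n)) ∧ U.d e = freeMap f g r w x ∧
      ∀ n, U.d (v (n + 1)) = coeff f g (n + 1) • v n +
        (-1 : ℤ) ^ (n + 1) • freeMap f g r w (y f g (n + 1) • x) := by
  have := hU.free
  have := U.free_carrier hU.free
  obtain ⟨x, hx, hxe⟩ := h.exists_lift he
  have hxm : x ∈ freeSpan f g r {p | p.1.1 < m} := freeSpan_mono (fun p hp => by
    simp only [Set.mem_ofPred_eq] at hp ⊢; omega) hx
  have hyx : ∀ n, y f g n • x ∈ freeSpan f g r {p | p.1.1 < m ∧ p.1.1 + p.2 + 1 = m + n} :=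
    fun n => y_smul_mem_freeSpan n (fun p hp => by
      simp only [Set.mem_ofPred_eq] at hp ⊢; omega) hx
  have hx0 : m = 0 → x = 0 := by
    rintro rfl
    rw [mem_freeSpan_iff, Finsupp.mem_supported'] at hxm
    rw [← (freeBasis f g _).repr.map_eq_zero_iff]
    ext p
    exact hxm p (by simp)
  -- `x` maps to the cycle ∂e, and the map is injective on the lower symbols, so `x` is itself a
  -- cycle.
  have hDx : freeD δ x = 0 := by
    match m with
    | 0 => rw [hx0 rfl, map_zero]
    | m + 1 =>
      have h1 : freeD δ x ∈ freeSpan f g r {p | p.1.1 < m + 1 ∧ p.1.1 + p.2 + 1 = m} :=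
        freeD_mem_freeSpan h.δ_mem (freeSpan_mono (fun p hp => by
          simp only [Set.mem_ofPred_eq] at hp ⊢; omega) hx)
      refine h.eq_zero_of_freeMap_eq_zero (freeSpan_mono (fun p hp => hp.1) h1) ?_
      rw [← h.d_freeMap hxm, hxe, U.d_d]
  have hq : ∀ n, (-1 : ℤ) ^ (n + 1) • freeMap f g r w (y f g (n + 1) • x) ∈ U.deg (m + n) := by
    intro n
    refine zsmul_mem (h.freeMap_mem_deg (freeSpan_mono (fun p hp => ?_) (hyx (n + 1)))) _
    simp only [Set.mem_ofPred_eq] at hp ⊢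
    omega
  have hqd : ∀ n, U.d ((-1 : ℤ) ^ (n + 1) • freeMap f g r w (y f g (n + 1) • x)) =
      -(coeff f g (n + 1) • ((-1 : ℤ) ^ n • freeMap f g r w (y f g n • x))) := by
    intro n
    rw [map_zsmul, h.d_freeMap (freeSpan_mono (fun p hp => hp.1) (hyx (n + 1))),
      freeD_smul δ (y_mem_deg f g (n + 1)), hDx, smul_zero, smul_zero, add_zero, d_y_succ,
      smul_assoc, map_smul, pow_succ, mul_neg_one, neg_smul, smul_comm]
  obtain ⟨v, hv0, hv, hvd⟩ := hU.exists_lift_sequence hfM hfg m he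
    (fun n => (-1 : ℤ) ^ n • freeMap f g r w (y f g n • x)) hq
    (by simp only [pow_zero, one_smul, ← one_def, hxe]) hqd
    (fun h0 => by simp [hx0 h0])
  exact ⟨x, hx, v, hv0, hv, hxe.symm, hvd⟩

end IsPartialResolution

end Existence

/-! ### Independence modulo the maximal ideal, the inductive step and the limit. -/

section Existence

open IsLocalRing TateAlgebra

variable {Q : Type u} [CommRing Q] {f g : Q} {r : ℕ → ℕ} [IsLocalRing Q]

theorem IndepModMaxOn.congr {κ P : Type*} [AddCommGroup P] [Module Q P] {v v' : κ → P} {S : Set κ}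
    (h : IndepModMaxOn Q v S) (hvv : ∀ p ∈ S, v p = v' p) : IndepModMaxOn Q v' S := by
  intro c hc hcv
  refine h c hc ?_
  convert hcv using 1
  rw [Finsupp.linearCombination_apply, Finsupp.linearCombination_apply]
  exact Finset.sum_congr rfl fun p hp => congrArg (c p • ·) (hvv p (hc hp))

theorem IndepModMaxOn.mono {κ P : Type*} [AddCommGroup P] [Module Q P] {v : κ → P} {S T : Set κ}
    (h : IndepModMaxOn Q v T) (hST : S ⊆ T) : IndepModMaxOn Q v S :=
  fun c hc => h c (Finsupp.supported_mono hST hc)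

theorem IndepModMaxOn.of_basis {ι κ P : Type*} [AddCommGroup P] [Module Q P]
    {N : Submodule Q P} (b : Module.Basis ι Q N) {J : ι → κ} {v : κ → P}
    (hJ : Function.Injective J) (hb : ∀ i, (b i : P) = v (J i))
    (hN : ∀ x : N, (x : P) ∈ maximalIdeal Q • (⊤ : Submodule Q P) →
      x ∈ maximalIdeal Q • (⊤ : Submodule Q N)) :
    IndepModMaxOn Q v (Set.range J) := by
  intro c hc hcv p
  obtain ⟨c, rfl⟩ : ∃ c₀ : ι →₀ Q, c₀.mapDomain J = c :=
    ⟨_, Finsupp.mapDomain_comapDomain J hJ c hc⟩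
  have h1 : ((Finsupp.linearCombination Q b c : N) : P) =
      Finsupp.linearCombination Q v (c.mapDomain J) := by
    rw [Finsupp.linearCombination_mapDomain, ← N.subtype_apply,
      LinearMap.map_finsupp_linearCombination]
    have h : N.subtype ∘ b = v ∘ J := funext hb
    rw [h]
  rw [← h1] at hcv
  have h2 := (b.mem_smul_top_iff_repr _ _).1 (hN _ hcv)
  rw [b.repr_linearCombination] at h2
  by_cases hp : p ∈ Set.range J
  · obtain ⟨i, rfl⟩ := hp
    rw [Finsupp.mapDomain_apply hJ]
    exact h2 i
  · rw [Finsupp.mapDomain_of_notMem_range _ _ hp]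
    exact zero_mem _

/-- The induction runs over the internal degrees m + j. In degree m the family is a basis. To pass
to the next degree, apply the differential: it sends 𝔫U to 𝔫²U, and independence in degree m + j,
used with the ideal 𝔫², controls the coefficients of the boundary. On symbols of degree m these are
f or g times the original ones, which forces the latter into 𝔫. The remaining terms lie on older
symbols. -/
theorem indepModMaxOn_succ {U : GradedComplex Q} {m : ℕ} {w : (Σ _ : GradedSymbols r, ℕ) → U}
    {δ : GradedSymbols r → GradedSymbols r →₀ TateAlgebra f g}
    {M : Type u} [AddCommGroup M] [Module Q M] {ε : U →ₗ[Q] M} (hU : U.IsMinimalFreeResolution ε)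
    (hf2 : f ∉ maximalIdeal Q ^ 2) (hg2 : g ∉ maximalIdeal Q ^ 2)
    (b : Module.Basis ((Σ i : Fin m, Fin (r i)) ⊕ Fin (r m)) Q (U.deg m))
    (hb : ∀ q, (b q : U) = w (degIndex r m q))
    (hdeg : ∀ p, p.1.1 < m + 1 → w p ∈ U.deg (p.1.1 + p.2))
    (hδ : ∀ l : GradedSymbols r, l.1 < m + 1 → δ l ∈ freeSpan f g r {p | p.1.1 + p.2 + 1 = l.1})
    (hd : ∀ p, p.1.1 < m + 1 → U.d (w p) = freeMap f g r w (freeD δ (freeBasis f g _ p)))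
    (hw : IndepModMaxOn Q w {p | p.1.1 < m}) : IndepModMaxOn Q w {p | p.1.1 < m + 1} := by
  classical
  have := hU.free
  have := U.free_carrier hU.free
  have main : ∀ j, IndepModMaxOn Q w {p | p.1.1 < m + 1 ∧ p.1.1 + p.2 = m + j} := by
    intro j
    induction j with
    | zero =>
      rw [add_zero, ← range_degIndex]
      exact IndepModMaxOn.of_basis b (degIndex_injective m) hb fun x hx => U.mem_smul_top_deg _ x hx
    | succ j ih =>
      intro c hc hcv
      obtain ⟨x, rfl⟩ := (freeBasis f g (GradedSymbols r)).repr.surjective c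
      rw [← freeMap_apply] at hcv
      have hx := mem_freeSpan_iff.2 hc
      have hx' : x ∈ freeSpan f g r {p | p.1.1 < m + 1} := freeSpan_mono (fun p hp => hp.1) hx
      have hDx : freeD δ x ∈ freeSpan f g r {p | p.1.1 < m + 1 ∧ p.1.1 + p.2 = m + j} := by
        refine freeSpan_mono (fun p hp => ?_) (freeD_mem_freeSpan hδ hx)
        simp only [Set.mem_ofPred_eq] at hp ⊢
        omega
      have hd2 := hU.d_mem_mul_smul _ hcv
      rw [d_freeMap_of_mem hd hx', freeMap_apply] at hd2
      have htop : ∀ p, p.1.1 = m → (freeBasis f g _).repr x p ∈ maximalIdeal Q := by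
        rintro ⟨l, k⟩ hl
        simp only at hl
        by_cases hk : l.1 + k = m + (j + 1)
        · obtain rfl : k = j + 1 := by omega
          have h1 := ih.mem_of_mem_smul _ (mem_freeSpan_iff.1 hDx) hd2 ⟨l, j⟩
          rw [repr_freeD_of_top hδ hx' l hl] at h1
          -- A unit coefficient would put f or g into 𝔫².
          by_contra hu
          rw [IsLocalRing.notMem_maximalIdeal] at hu
          rw [Ideal.mul_unit_mem_iff_mem _ hu, ← pow_two] at h1
          unfold coeff at h1
          split_ifs at h1
          · exact hf2 h1
          · exact hg2 h1
        · rw [(Finsupp.mem_supported' _ _).1 hc ⟨l, k⟩ fun h => hk h.2]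
          exact zero_mem _
      -- The part on symbols of degree m now lies in 𝔫U and can be subtracted, which leaves a
      -- combination to which `hw` applies.
      have hsplit := Finsupp.filter_add_filter_not ((freeBasis f g _).repr x)
        (fun p : Σ _ : GradedSymbols r, ℕ => p.1.1 < m)
      have hlow := hw (((freeBasis f g _).repr x).filter fun p => p.1.1 < m) (by
        rw [Finsupp.mem_supported, Finsupp.support_filter]
        intro p hp
        exact (Finset.mem_filter.1 hp).2) (by
        rw [← eq_sub_iff_add_eq] at hsplit
        rw [hsplit, map_sub, ← freeMap_apply]
        refine sub_mem hcv ?_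
        rw [Finsupp.linearCombination_apply, Finsupp.sum]
        refine Submodule.sum_mem _ fun p hp => Submodule.smul_mem_smul ?_ trivial
        rw [Finsupp.support_filter, Finset.mem_filter] at hp
        rw [Finsupp.filter_apply_pos (fun p : Σ _ : GradedSymbols r, ℕ => ¬ p.1.1 < m) _ hp.2]
        refine htop p ?_
        have h1 := (hc hp.1).1
        have h2 := hp.2
        omega)
      intro p
      by_cases hp : p.1.1 < m
      · have := hlow p
        rwa [Finsupp.filter_apply_pos (fun p : Σ _ : GradedSymbols r, ℕ => p.1.1 < m) _ hp] at this
      · by_cases hp' : p.1.1 = m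
        · exact htop p hp'
        · rw [(Finsupp.mem_supported' _ _).1 hc p fun h => by
            have := h.1
            omega]
          exact zero_mem _
  refine IndepModMaxOn.of_homogeneous (t := fun p => p.1.1 + p.2) hdeg fun j => ?_
  -- Below degree m only older symbols occur, so there the hypothesis `hw` suffices.
  by_cases hj : m ≤ j
  · have := main (j - m)
    rwa [Nat.add_sub_cancel' hj] at this
  · refine hw.mono fun p hp => ?_
    simp only [Set.mem_ofPred_eq] at hp ⊢
    omega

theorem IsPartialResolution.exists_succ {U : GradedComplex Q} {m : ℕ}
    {w : (Σ _ : GradedSymbols r, ℕ) → U}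
    {δ : GradedSymbols r → GradedSymbols r →₀ TateAlgebra f g}
    {M : Type u} [AddCommGroup M] [Module Q M] {ε : U →ₗ[Q] M} (hU : U.IsMinimalFreeResolution ε)
    (hfM : ∀ m : M, f • m = 0) (hfg : f * g = 0)
    (hf2 : f ∉ maximalIdeal Q ^ 2) (hg2 : g ∉ maximalIdeal Q ^ 2)
    (hr : r m = Module.finrank Q (U.deg m) - ∑ i : Fin m, r i)
    (h : IsPartialResolution U m w δ) :
    ∃ (w' : (Σ _ : GradedSymbols r, ℕ) → U)
      (δ' : GradedSymbols r → GradedSymbols r →₀ TateAlgebra f g),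
      IsPartialResolution U (m + 1) w' δ' ∧ (∀ p, p.1.1 < m → w' p = w p) ∧
        ∀ l, l.1 < m → δ' l = δ l := by
  classical
  have := hU.free
  have := hU.finite
  obtain ⟨b, hb⟩ := h.exists_basis_deg hr
  -- The data are specified only for symbols of degree m and are arbitrary for all others, so that a
  -- choice can be made uniformly in `l`.
  have hnew : ∀ l : GradedSymbols r, ∃ (x : GradedSymbols r →₀ TateAlgebra f g) (v : ℕ → U),
      l.1 = m → x ∈ freeSpan f g r {p | p.1.1 + p.2 + 1 = l.1} ∧
        (∀ k : Fin (r m), l = ⟨m, k⟩ → v 0 = b (Sum.inr k)) ∧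
        (∀ n, v n ∈ U.deg (l.1 + n)) ∧ U.d (v 0) = freeMap f g r w x ∧
        ∀ n, U.d (v (n + 1)) = coeff f g (n + 1) • v n +
          (-1 : ℤ) ^ (n + 1) • freeMap f g r w (y f g (n + 1) • x) := by
    rintro ⟨i, k⟩
    by_cases hi : i = m
    · subst hi
      obtain ⟨x, hx, v, hv0, hv, hvd, hvs⟩ := h.exists_symbol hU hfM hfg (b (Sum.inr k)).2
      refine ⟨x, v, fun _ => ⟨hx, ?_, hv, by rw [hv0, hvd], hvs⟩⟩
      intro k' hk
      cases hk
      exact hv0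
    · exact ⟨0, 0, fun h => (hi h).elim⟩
  choose x v hxv using hnew
  let w' : (Σ _ : GradedSymbols r, ℕ) → U := fun p => if p.1.1 < m then w p else v p.1 p.2
  let δ' : GradedSymbols r → GradedSymbols r →₀ TateAlgebra f g :=
    fun l => if l.1 < m then δ l else x l
  have hw : ∀ p, p.1.1 < m → w' p = w p := fun p hp => if_pos hp
  have hw' : ∀ p : (Σ _ : GradedSymbols r, ℕ), p.1.1 = m → w' p = v p.1 p.2 :=
    fun p hp => if_neg (by omega)
  have hδ : ∀ l, l.1 < m → δ' l = δ l := fun l hl => if_pos hl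
  have hδ' : ∀ l : GradedSymbols r, l.1 = m → δ' l = x l := fun l hl => if_neg (by omega)
  have hdeg : ∀ p, p.1.1 < m + 1 → w' p ∈ U.deg (p.1.1 + p.2) := by
    intro p hp
    rcases Nat.lt_succ_iff_lt_or_eq.1 hp with hp | hp
    · rw [hw p hp]; exact h.mem_deg p hp
    · rw [hw' p hp]; exact (hxv p.1 hp).2.2.1 p.2
  have hδm : ∀ l : GradedSymbols r, l.1 < m + 1 →
      δ' l ∈ freeSpan f g r {p | p.1.1 + p.2 + 1 = l.1} := by
    intro l hl
    rcases Nat.lt_succ_iff_lt_or_eq.1 hl with hl | hl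
    · rw [hδ l hl]; exact h.δ_mem l hl
    · rw [hδ' l hl]; exact (hxv l hl).1
  have hmap : ∀ z ∈ freeSpan f g r {p | p.1.1 < m}, freeMap f g r w' z = freeMap f g r w z :=
    fun z hz => freeMap_congr hw hz
  have hd : ∀ p, p.1.1 < m + 1 → U.d (w' p) = freeMap f g r w' (freeD δ' (freeBasis f g _ p)) := by
    intro p hp
    rcases Nat.lt_succ_iff_lt_or_eq.1 hp with hp | hp
    · have hβ : freeBasis f g _ p ∈ freeSpan f g r {q | q.1.1 < m ∧ q.1.1 + q.2 = p.1.1 + p.2} :=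
        Submodule.subset_span ⟨p, ⟨hp, rfl⟩, rfl⟩
      rw [hw p hp, h.d_eq p hp, freeD_congr (fun q hq => hδ q.1 hq)
        (freeSpan_mono (fun q hq => hq.1) hβ), hmap]
      exact freeSpan_mono (fun q hq => hq.1) (freeD_mem_freeSpan h.δ_mem hβ)
    · obtain ⟨l, n⟩ := p
      have hl : l.1 = m := hp
      obtain ⟨h1, -, -, h4, h5⟩ := hxv l hl
      have h6 : ∀ n, y f g n • x l ∈ freeSpan f g r {p | p.1.1 < m} := fun n =>
        y_smul_mem_freeSpan n (fun p hp => by simp only [Set.mem_ofPred_eq] at hp ⊢; omega) h1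
      rw [freeD_freeBasis, hw' _ hl, map_add, map_zsmul]
      simp only
      rw [hδ' l hl, hmap _ (h6 n)]
      match n with
      | 0 =>
        rw [h4, d_y_zero, Finsupp.single_zero, map_zero, zero_add, pow_zero, one_smul, ← one_def,
          one_smul]
      | n + 1 =>
        rw [h5, d_y_succ, ← Finsupp.smul_single, LinearMap.map_smul]
        congr 2
        have h7 := freeMap_freeBasis (f := f) (g := g) w' ⟨l, n⟩
        rw [freeBasis_apply, hw' _ hl] at h7
        exact h7.symm
  have hbw : ∀ q, (b q : U) = w' (degIndex r m q) := by
    rintro (q | k)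
    · rw [hb, hw _ q.1.2]
    · rw [hw' _ rfl]
      exact ((hxv ⟨m, k⟩ rfl).2.1 k rfl).symm
  refine ⟨w', δ', ⟨hdeg, hδm, hd, ?_, ?_⟩, hw, hδ⟩
  · exact indepModMaxOn_succ hU hf2 hg2 b hbw hdeg hδm hd (h.indep.congr fun p hp => (hw p hp).symm)
  · intro j hj u hu
    rcases Nat.lt_succ_iff_lt_or_eq.1 hj with hj | rfl
    · obtain ⟨z, hz, rfl⟩ := h.surj j hj u hu
      refine ⟨z, hz, hmap _ (freeSpan_mono (fun p hp => ?_) hz)⟩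
      simp only [Set.mem_ofPred_eq] at hp ⊢
      omega
    · refine ⟨∑ q, b.repr ⟨u, hu⟩ q • freeBasis f g _ (degIndex r j q), ?_, ?_⟩
      · refine Submodule.sum_mem _ fun q _ => Submodule.smul_mem _ _
          (Submodule.subset_span ⟨_, ?_, rfl⟩)
        have : degIndex r j q ∈ Set.range (degIndex r j) := ⟨q, rfl⟩
        rw [range_degIndex] at this
        exact this.2
      · rw [map_sum]
        simp only [map_smul, freeMap_freeBasis, ← hbw]
        have h8 := congrArg (U.deg j).subtype (b.sum_repr ⟨u, hu⟩)
        rw [map_sum] at h8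
        simpa using h8

theorem IsPartialResolution.congr {U : GradedComplex Q} {m : ℕ}
    {w w' : (Σ _ : GradedSymbols r, ℕ) → U}
    {δ δ' : GradedSymbols r → GradedSymbols r →₀ TateAlgebra f g}
    (h : IsPartialResolution U m w δ) (hw : ∀ p, p.1.1 < m → w p = w' p)
    (hδ : ∀ l, l.1 < m → δ l = δ' l) : IsPartialResolution U m w' δ' := by
  have hmap : ∀ z ∈ freeSpan f g r {p | p.1.1 < m}, freeMap f g r w z = freeMap f g r w' z :=
    fun z hz => freeMap_congr hw hz
  refine ⟨fun p hp => hw p hp ▸ h.mem_deg p hp, fun l hl => hδ l hl ▸ h.δ_mem l hl,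
    fun p hp => ?_, h.indep.congr hw, fun j hj u hu => ?_⟩
  · have hβ : freeBasis f g _ p ∈ freeSpan f g r {q | q.1.1 < m ∧ q.1.1 + q.2 = p.1.1 + p.2} :=
      Submodule.subset_span ⟨p, ⟨hp, rfl⟩, rfl⟩
    rw [← hw p hp, h.d_eq p hp, ← freeD_congr (fun q hq => hδ q.1 hq)
      (freeSpan_mono (fun q hq => hq.1) hβ)]
    exact hmap _ (freeSpan_mono (fun q hq => hq.1) (freeD_mem_freeSpan h.δ_mem hβ))
  · obtain ⟨z, hz, rfl⟩ := h.surj j hj u hu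
    refine ⟨z, hz, (hmap _ (freeSpan_mono (fun p hp => ?_) hz)).symm⟩
    simp only [Set.mem_ofPred_eq] at hp ⊢
    omega

/-- Each step leaves the data on older symbols unchanged, so the values at a symbol of degree i are
final from stage i + 1 on and are read off there. -/
theorem exists_limit_of_forall_exists_succ {U : GradedComplex Q}
    (step : ∀ (m : ℕ) (w : (Σ _ : GradedSymbols r, ℕ) → U)
      (δ : GradedSymbols r → GradedSymbols r →₀ TateAlgebra f g), IsPartialResolution U m w δ →
        ∃ (w' : (Σ _ : GradedSymbols r, ℕ) → U)
          (δ' : GradedSymbols r → GradedSymbols r →₀ TateAlgebra f g),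
          IsPartialResolution U (m + 1) w' δ' ∧ (∀ p, p.1.1 < m → w' p = w p) ∧
            ∀ l, l.1 < m → δ' l = δ l) :
    ∃ (w : (Σ _ : GradedSymbols r, ℕ) → U)
      (δ : GradedSymbols r → GradedSymbols r →₀ TateAlgebra f g),
      ∀ m, IsPartialResolution U m w δ := by
  choose! W D hWD hW hD using step
  have hzero : IsPartialResolution U 0 (0 : (Σ _ : GradedSymbols r, ℕ) → U)
      (0 : GradedSymbols r → GradedSymbols r →₀ TateAlgebra f g) := by
    refine ⟨fun p hp => (Nat.not_lt_zero _ hp).elim, fun l hl => (Nat.not_lt_zero _ hl).elim,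
      fun p hp => (Nat.not_lt_zero _ hp).elim, fun c hc _ p => ?_,
      fun j hj => (Nat.not_lt_zero _ hj).elim⟩
    rw [(Finsupp.mem_supported' _ _).1 hc p (by simp)]
    exact zero_mem _
  obtain ⟨s, hs0, hs⟩ : ∃ s : ℕ → ((Σ _ : GradedSymbols r, ℕ) → U) ×
      (GradedSymbols r → GradedSymbols r →₀ TateAlgebra f g),
      s 0 = ⟨0, 0⟩ ∧ ∀ m, s (m + 1) = ⟨W m (s m).1 (s m).2, D m (s m).1 (s m).2⟩ :=
    ⟨fun m => Nat.rec ⟨0, 0⟩ (fun m s => ⟨W m s.1 s.2, D m s.1 s.2⟩) m, rfl, fun _ => rfl⟩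
  have hp : ∀ m, IsPartialResolution U m (s m).1 (s m).2 := by
    intro m
    induction m with
    | zero => rw [hs0]; exact hzero
    | succ m ih => rw [hs]; exact hWD m _ _ ih
  have hmn : ∀ m n, m ≤ n → (∀ p, p.1.1 < m → (s n).1 p = (s m).1 p) ∧
      ∀ l, l.1 < m → (s n).2 l = (s m).2 l := by
    intro m n hmn
    induction n, hmn using Nat.le_induction with
    | base => exact ⟨fun _ _ => rfl, fun _ _ => rfl⟩
    | succ n hmn ih =>
      rw [hs]
      exact ⟨fun p h => (hW n _ _ (hp n) p (by omega)).trans (ih.1 p h),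
        fun l h => (hD n _ _ (hp n) l (by omega)).trans (ih.2 l h)⟩
  exact ⟨fun p => (s (p.1.1 + 1)).1 p, fun l => (s (l.1 + 1)).2 l, fun m => (hp m).congr
    (fun p h => (hmn (p.1.1 + 1) m h).1 p (Nat.lt_succ_self _))
    fun l h => (hmn (l.1 + 1) m h).2 l (Nat.lt_succ_self _)⟩

/-- Injectivity may be tested at a finite stage, since an element involves finitely many symbols;
surjectivity may be tested in one degree at a time. -/
theorem exists_semiFree_of_isPartialResolution {U : GradedComplex Q} [Module.Projective Q U]
    {w : (Σ _ : GradedSymbols r, ℕ) → U}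
    {δ : GradedSymbols r → GradedSymbols r →₀ TateAlgebra f g}
    (h : ∀ m, IsPartialResolution U m w δ) :
    ∃ (_ : Module (TateAlgebra f g) U) (_ : IsDGModule f g U), IsSemiFree f g U := by
  have hinj : Function.Injective (freeMap f g r w) := by
    rw [injective_iff_map_eq_zero]
    intro z hz
    refine (h (((freeBasis f g _).repr z).support.sup (fun p => p.1.1) + 1)).eq_zero_of_freeMap_eq_zero
      ?_ hz
    rw [mem_freeSpan_iff, Finsupp.mem_supported]
    intro p hp
    exact Nat.lt_succ_iff.2 (Finset.le_sup (f := fun p : Σ _ : GradedSymbols r, ℕ => p.1.1) hp)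
  have hsurj : Function.Surjective (freeMap f g r w) := by
    intro u
    induction u using GradedComplex.induction_deg with
    | hadd u v hu hv =>
      obtain ⟨a, rfl⟩ := hu
      obtain ⟨b, rfl⟩ := hv
      exact ⟨a + b, map_add _ _ _⟩
    | hdeg j u hu =>
      obtain ⟨z, -, rfl⟩ := (h (j + 1)).surj j (Nat.lt_succ_self _) u hu
      exact ⟨z, rfl⟩
  refine exists_semiFree_of_linearEquiv (fun l : GradedSymbols r => l.1) δ
    (LinearEquiv.ofBijective (freeMap f g r w) ⟨hinj, hsurj⟩) (fun p => ?_) fun z => ?_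
  · have := (h (p.1.1 + 1)).mem_deg p (Nat.lt_succ_self _)
    rw [← freeMap_freeBasis (f := f) (g := g) w p] at this
    exact this
  · refine d_freeMap_of_mem (S := Set.univ)
      (fun p _ => (h (p.1.1 + 1)).d_eq p (Nat.lt_succ_self _)) (x := z) ?_
    rw [mem_freeSpan_iff, Finsupp.supported_univ]
    trivial

/-- Every minimal free resolution over `Q` of a module annihilated by `f` has a structure of
semi-free dg module over the Tate construction. -/
theorem GradedComplex.IsMinimalFreeResolution.exists_semiFree {U : GradedComplex Q}
    {M : Type u} [AddCommGroup M] [Module Q M] {ε : U →ₗ[Q] M} (hU : U.IsMinimalFreeResolution ε)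
    (hfM : ∀ m : M, f • m = 0) (hfg : f * g = 0)
    (hf2 : f ∉ maximalIdeal Q ^ 2) (hg2 : g ∉ maximalIdeal Q ^ 2) :
    ∃ (_ : Module (TateAlgebra f g) U) (_ : IsDGModule f g U), IsSemiFree f g U := by
  have := hU.free
  have := U.free_carrier hU.free
  obtain ⟨r, hr⟩ : ∃ r : ℕ → ℕ, ∀ m, r m = Module.finrank Q (U.deg m) - ∑ i : Fin m, r i := by
    -- The number of new symbols in degree m depends on all earlier numbers, hence the strong
    -- recursion.
    let r : ℕ → ℕ := WellFounded.fix Nat.lt_wfRel.wf fun m r =>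
      Module.finrank Q (U.deg m) - ∑ i : Fin m, r i i.2
    exact ⟨r, fun m => WellFounded.fix_eq ..⟩
  obtain ⟨w, δ, h⟩ := exists_limit_of_forall_exists_succ (f := f) (g := g) (r := r)
    fun m w δ h => h.exists_succ hU hfM hfg hf2 hg2 (hr m)
  exact exists_semiFree_of_isPartialResolution h

end Existence

/-! ### Acyclicity of the augmentation ideal for an exact pair. -/

section Exactness

open IsLocalRing TateAlgebra GradedComplex

variable {Q : Type u} [CommRing Q] {f g : Q}

theorem IsExactZeroDivisorPair.exists_coeff_mul (h : IsExactZeroDivisorPair f g) (n : ℕ) {a : Q}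
    (ha : a * coeff f g (n + 1) = 0) : ∃ c, a = c * coeff f g (n + 2) := by
  have key : ∀ {x y : Q}, (Ideal.span {x}).annihilator = Ideal.span {y} → a * x = 0 →
      ∃ c, a = c * y := by
    intro x y hxy hax
    have : a ∈ (Ideal.span {x}).annihilator := by
      rw [← Ideal.submodule_span_eq, Submodule.mem_annihilator_span_singleton]
      exact hax
    rw [hxy] at this
    obtain ⟨c, hc⟩ := Ideal.mem_span_singleton'.1 this
    exact ⟨c, hc.symm⟩
  unfold coeff at ha ⊢
  rcases Nat.mod_two_eq_zero_or_one n with hn | hn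
  · rw [if_pos (by omega)] at ha
    rw [if_neg (by omega)]
    exact key h.1 ha
  · rw [if_neg (by omega)] at ha
    rw [if_pos (by omega)]
    exact key h.2 ha

/-- If `(f, g)` is a pair of exact zero divisors then the kernel of the augmentation of the Tate
construction is acyclic. -/
theorem IsExactZeroDivisorPair.exists_d_eq (h : IsExactZeroDivisorPair f g) (a : TateAlgebra f g)
    (hd : TateAlgebra.d f g a = 0) (ha : aug f g a = 0) :
    ∃ b, aug f g b = 0 ∧ TateAlgebra.d f g b = a := by
  -- For n > 0 the coefficient of yₙ annihilates fₙ because `a` is a cycle, so exactness of the pair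
  -- applies. For n = 0 divisibility by f is the vanishing of the augmentation.
  have hc : ∀ n, ∃ c, (basis f g).repr a n = c * coeff f g (n + 1) := by
    intro n
    match n with
    | 0 =>
      have h1 : aug f g a = Ideal.Quotient.mk _ ((basis f g).repr a 0) := by
        clear hd ha
        change augHom f g a = _
        induction a using basis_induction with
        | h0 => simp
        | hadd a b ha hb => simp only [map_add, ha, hb, Finsupp.add_apply]
        | hsmul r a ha =>
          rw [map_smul, ha, map_smul, Finsupp.smul_apply, smul_eq_mul, map_mul]
          rfl
        | hy n =>
          rw [augHom_y, Module.Basis.repr_self]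
          by_cases hn : n = 0
          · subst hn; simp
          · rw [if_neg hn, Finsupp.single_eq_of_ne' hn, map_zero]
      rw [h1, Ideal.Quotient.eq_zero_iff_mem] at ha
      obtain ⟨c, hc⟩ := Ideal.mem_span_singleton'.1 ha
      exact ⟨c, hc.symm⟩
    | n + 1 =>
      refine h.exists_coeff_mul n ?_
      have := repr_d f g a n
      rw [hd] at this
      simpa [mul_comm] using this.symm
  choose c hc using hc
  -- The primitive has no y₀-term, so it stays in the augmentation ideal.
  refine ⟨∑ n ∈ ((basis f g).repr a).support, c n • y f g (n + 1), ?_, ?_⟩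
  · rw [map_sum]
    refine Finset.sum_eq_zero fun n _ => ?_
    rw [map_smul]
    have : aug f g (y f g (n + 1)) = 0 := augHom_y f g (n + 1)
    rw [this, smul_zero]
  · rw [map_sum]
    conv_rhs => rw [← (basis f g).linearCombination_repr a, Finsupp.linearCombination_apply]
    refine Finset.sum_congr rfl fun n _ => ?_
    rw [map_smul, d_y_succ, smul_smul, ← hc]

end Exactness

/-! ### Semi-free modules and the kernel of U → U ⊗_A R. -/

namespace GradedComplex

section SemiFree

open IsLocalRing TateAlgebra

variable {Q : Type u} [CommRing Q] {f g : Q} {U : GradedComplex Q} [Module (TateAlgebra f g) U]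
  {Λ : Type u} (e : Module.Basis Λ (TateAlgebra f g) U)

/-- The basis of `U ⊗_A R` over `R` induced by a basis of `U` over `A`. -/
noncomputable def tensorBasis : Module.Basis Λ (Q ⧸ Ideal.span {f}) (TensorCarrier f g U) :=
  Algebra.TensorProduct.basis (Q ⧸ Ideal.span {f}) e

theorem tensorBasis_apply (l : Λ) : tensorBasis e l = U.toTensor (e l) :=
  Algebra.TensorProduct.basis_apply e l

/-- Identifies the kernel of U → U ⊗_A R as the elements whose A-coordinates all lie in the
augmentation ideal. -/
theorem toTensor_eq_zero_iff (u : U) :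
    (U.toTensor u : TensorCarrier f g U) = 0 ↔ ∀ l, aug f g (e.repr u l) = 0 := by
  rw [← (tensorBasis e).repr.map_eq_zero_iff]
  have : (tensorBasis e).repr (U.toTensor u) =
      (1 : Q ⧸ Ideal.span {f}) • Finsupp.mapRange (algebraMap (TateAlgebra f g) _) (map_zero _)
        (e.repr u) := Algebra.TensorProduct.basis_repr_tmul e 1 u
  rw [this, one_smul, Finsupp.ext_iff]
  rfl

theorem toTensor_surjective :
    Function.Surjective (U.toTensor : U → TensorCarrier f g U) := by
  intro x
  induction x using TensorProduct.induction_on with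
  | zero => exact ⟨0, map_zero _⟩
  | add x y hx hy =>
    obtain ⟨a, rfl⟩ := hx
    obtain ⟨b, rfl⟩ := hy
    exact ⟨a + b, map_add _ _ _⟩
  | tmul r u =>
    obtain ⟨q, rfl⟩ := Ideal.Quotient.mk_surjective r
    refine ⟨algebraMap Q (TateAlgebra f g) q • u, ?_⟩
    rw [map_smul]
    change algebraMap Q (TateAlgebra f g) q • ((1 : Q ⧸ Ideal.span {f}) ⊗ₜ[TateAlgebra f g] u) = _
    rw [TensorProduct.smul_tmul', Algebra.smul_def, mul_one,
      ← IsScalarTower.algebraMap_apply Q (TateAlgebra f g)]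
    rfl

variable [IsDGModule f g U] (δ : Λ → ℕ) (he : ∀ l, e l ∈ U.deg (δ l))

/-- The `Q`-basis `yₙ e_l` of a semi-free dg module with basis `e`. -/
noncomputable def semiFreeBasis : Module.Basis (ℕ × Λ) Q U := (basis f g).smulTower e

theorem semiFreeBasis_apply (p : ℕ × Λ) : semiFreeBasis e p = y f g p.1 • e p.2 :=
  Module.Basis.smulTower_apply ..

theorem semiFreeBasis_repr (u : U) (p : ℕ × Λ) :
    (semiFreeBasis e).repr u p = (basis f g).repr (e.repr u p.2) p.1 :=
  Module.Basis.smulTower_repr ..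

include he in
theorem semiFreeBasis_mem_deg (p : ℕ × Λ) : semiFreeBasis e p ∈ U.deg (p.1 + δ p.2) := by
  rw [semiFreeBasis_apply]
  exact IsDGModule.smul_mem_deg _ _ _ _ (y_mem_deg f g p.1) (he p.2)

include he in
theorem repr_eq_zero_of_mem_deg {n : ℕ} {u : U} (hu : u ∈ U.deg n) {l : Λ} (hl : n < δ l) :
    e.repr u l = 0 := by
  rw [← (basis f g).repr.map_eq_zero_iff]
  ext k
  by_contra hk
  rw [← semiFreeBasis_repr e u (k, l)] at hk
  have := (mem_deg_iff_repr (semiFreeBasis e) _ (semiFreeBasis_mem_deg e δ he) n u).1 hu _ hk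
  simp only at this
  omega

include he in
theorem repr_d_e_eq_zero {l l' : Λ} (hl : δ l ≤ δ l') : e.repr (U.d (e l)) l' = 0 := by
  have h := he l
  match hn : δ l with
  | 0 =>
    rw [hn] at h
    rw [U.d_deg_zero _ h, map_zero, Finsupp.zero_apply]
  | n + 1 =>
    rw [hn] at h
    exact repr_eq_zero_of_mem_deg e δ he (U.d_deg_succ n _ h) (by omega)

include he in
/-- The leading coefficients of `∂ u` are the boundaries of the leading coefficients of `u`. -/
theorem repr_d_of_top {N : ℕ} {u : U} (hu : ∀ l, N < δ l → e.repr u l = 0) {l : Λ} (hl : N ≤ δ l) :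
    e.repr (U.d u) l = TateAlgebra.d f g (e.repr u l) := by
  have hu' : u ∈ Submodule.span Q (semiFreeBasis e '' {p | δ p.2 ≤ N}) := by
    rw [Module.Basis.mem_span_image]
    intro p hp
    by_contra hpN
    rw [Finset.mem_coe, Finsupp.mem_support_iff, semiFreeBasis_repr, hu p.2 (not_le.1 hpN),
      map_zero] at hp
    exact hp rfl
  clear hu
  have hsmul : ∀ (s : Q) (x : U), e.repr (s • x) l = s • e.repr x l := by
    intro s x
    rw [← algebraMap_smul (TateAlgebra f g) s x, map_smul, Finsupp.smul_apply, smul_eq_mul,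
      ← Algebra.smul_def]
  induction hu' using Submodule.span_induction with
  | zero => simp
  | add x y _ _ hx hy => simp only [map_add, Finsupp.add_apply, hx, hy]
  | smul s x _ hx => rw [map_smul, hsmul, hx, hsmul, map_smul]
  | mem x hx =>
    obtain ⟨⟨n, l'⟩, hl', rfl⟩ := hx
    have hl'' : δ l' ≤ N := hl'
    rw [semiFreeBasis_apply]
    simp only
    rw [IsDGModule.leibniz n _ _ (y_mem_deg f g n), map_add, map_zsmul, map_smul, map_smul,
      Finsupp.add_apply, Finsupp.smul_apply, Finsupp.smul_apply, Finsupp.smul_apply,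
      repr_d_e_eq_zero e δ he (hl''.trans hl), map_smul, Finsupp.smul_apply, smul_zero, smul_zero,
      add_zero, Module.Basis.repr_self]
    by_cases h : l' = l
    · subst h; simp
    · rw [Finsupp.single_eq_of_ne' h]; simp

include he in
-- Filter U by the degrees of the basis elements. By `repr_d_of_top` the leading coefficients of a
-- cycle are cycles of A; those of `z` lie in the augmentation ideal, so they bound there.
-- Subtracting a boundary removes them and lowers the filtration.
theorem exists_d_eq_of_toTensor_eq_zero (hfg : IsExactZeroDivisorPair f g) {z : U}
    (hd : U.d z = 0) (hz : (U.toTensor z : TensorCarrier f g U) = 0) :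
    ∃ v, (U.toTensor v : TensorCarrier f g U) = 0 ∧ U.d v = z := by
  classical
  have htd : ∀ v : U, (U.toTensor v : TensorCarrier f g U) = 0 →
      (U.toTensor (U.d v) : TensorCarrier f g U) = 0 := by
    intro v hv
    rw [← U.tensorMap_toTensor U.d fun _ => toTensor_d_y_smul U, hv, map_zero]
  -- `N` is a strict upper bound for the degrees of the basis elements that occur in `z`.
  have main : ∀ N : ℕ, ∀ z : U, U.d z = 0 → (U.toTensor z : TensorCarrier f g U) = 0 →
      (∀ l, N ≤ δ l → e.repr z l = 0) →
      ∃ v, (U.toTensor v : TensorCarrier f g U) = 0 ∧ U.d v = z := by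
    intro N
    induction N with
    | zero =>
      intro z _ _ h
      have : z = 0 := by
        rw [← e.repr.map_eq_zero_iff]
        ext l
        rw [h l (Nat.zero_le _), Finsupp.zero_apply]
      exact ⟨0, map_zero _, by rw [map_zero, this]⟩
    | succ N ih =>
      intro z hd hz h
      have hk : ∀ l, ∃ b, aug f g b = 0 ∧ (δ l = N → TateAlgebra.d f g b = e.repr z l) := by
        intro l
        by_cases hl : δ l = N
        · obtain ⟨b, hb, hbd⟩ := hfg.exists_d_eq (e.repr z l)
            (by rw [← repr_d_of_top e δ he (fun l hl => h l hl) hl.ge, hd, map_zero,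
              Finsupp.zero_apply]) ((toTensor_eq_zero_iff e z).1 hz l)
          exact ⟨b, hb, fun _ => hbd⟩
        · exact ⟨0, map_zero _, fun h => (hl h).elim⟩
      choose k hk0 hkd using hk
      let T := (e.repr z).support.filter fun l => δ l = N
      -- The primitives are kept only where `z` has a leading coefficient in its support; this makes
      -- the sum finite.
      let c : Λ →₀ TateAlgebra f g := Finsupp.onFinset T (fun l => if l ∈ T then k l else 0)
        fun l hl => by by_contra h; exact hl (if_neg h)
      have hc : ∀ l, c l = if l ∈ T then k l else 0 := fun _ => rfl
      have hv : ∀ l, e.repr (e.repr.symm c) l = if l ∈ T then k l else 0 := fun l => by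
        rw [LinearEquiv.apply_symm_apply, hc]
      have hv0 : (U.toTensor (e.repr.symm c) : TensorCarrier f g U) = 0 := by
        rw [toTensor_eq_zero_iff e]
        intro l
        rw [hv]
        split_ifs
        · exact hk0 l
        · exact map_zero _
      have hvtop : ∀ l, N < δ l → e.repr (e.repr.symm c) l = 0 := by
        intro l hl
        rw [hv, if_neg]
        intro hlT
        have := (Finset.mem_filter.1 hlT).2
        omega
      obtain ⟨v, hv1, hv2⟩ := ih (z - U.d (e.repr.symm c)) (by rw [map_sub, hd, U.d_d, sub_zero])
        (by rw [map_sub, hz, htd _ hv0, sub_zero]) (by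
          intro l hl
          rw [map_sub, Finsupp.sub_apply, repr_d_of_top e δ he hvtop hl, hv]
          split_ifs with hlT
          · rw [hkd l (Finset.mem_filter.1 hlT).2, sub_self]
          · rw [map_zero, sub_zero]
            rcases hl.lt_or_eq with hl | hl
            · exact h l hl
            · by_contra h0
              exact hlT (Finset.mem_filter.2 ⟨Finsupp.mem_support_iff.2 h0, hl.symm⟩))
      exact ⟨v + e.repr.symm c, by rw [map_add, hv1, hv0, add_zero],
        by rw [map_add, hv2, sub_add_cancel]⟩
  refine main ((e.repr z).support.sup δ + 1) z hd hz fun l hl => ?_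
  by_contra h0
  have := Finset.le_sup (f := δ) (Finsupp.mem_support_iff.2 h0)
  omega

end SemiFree

end GradedComplex

/-! ### From U to a minimal free resolution over Q/(f). -/

namespace GradedComplex

open IsLocalRing TateAlgebra

section TensorResolution

variable {Q : Type u} [CommRing Q] {f g : Q} {U : GradedComplex Q} [Module (TateAlgebra f g) U]
  [IsDGModule f g U] {Λ : Type u} (e : Module.Basis Λ (TateAlgebra f g) U) (δ : Λ → ℕ)
  (he : ∀ l, e l ∈ U.deg (δ l))

theorem tensor_d_toTensor (u : U) :
    (U.tensor f g).d (U.toTensor u : TensorCarrier f g U) = U.toTensor (U.d u) :=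
  U.tensorMap_toTensor U.d (fun _ => toTensor_d_y_smul U) u

omit [IsDGModule f g U] in
theorem toTensor_mem_tensorDeg {n : ℕ} {u : U} (hu : u ∈ U.deg n) :
    (U.toTensor u : TensorCarrier f g U) ∈ tensorDeg f g U n := Submodule.subset_span ⟨u, hu, rfl⟩

theorem exists_of_mem_tensorDeg {n : ℕ} {x : TensorCarrier f g U} (hx : x ∈ tensorDeg f g U n) :
    ∃ u ∈ U.deg n, U.toTensor u = x := by
  induction hx using Submodule.span_induction with
  | mem x hx => exact hx
  | zero => exact ⟨0, zero_mem _, map_zero _⟩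
  | add x y _ _ hx hy =>
    obtain ⟨a, ha, rfl⟩ := hx
    obtain ⟨b, hb, rfl⟩ := hy
    exact ⟨a + b, add_mem ha hb, map_add _ _ _⟩
  | smul r x _ hx =>
    obtain ⟨a, ha, rfl⟩ := hx
    obtain ⟨q, rfl⟩ := Ideal.Quotient.mk_surjective r
    exact ⟨q • a, Submodule.smul_mem _ _ ha, toTensor_smul U q a⟩

omit [IsDGModule f g U] in
include he in
theorem tensorBasis_mem_deg (l : Λ) : tensorBasis e l ∈ tensorDeg f g U (δ l) := by
  rw [tensorBasis_apply]
  exact toTensor_mem_tensorDeg (he l)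

include he in
theorem finite_tensorDeg [Nontrivial Q] (n : ℕ) [Module.Finite Q (U.deg n)] :
    Module.Finite (Q ⧸ Ideal.span {f}) ((U.tensor f g).deg n) := by
  obtain ⟨b⟩ := nonempty_basis_deg (semiFreeBasis e) _ (semiFreeBasis_mem_deg e δ he) n
  have : Finite {p : ℕ × Λ // p.1 + δ p.2 = n} := Module.Finite.finite_basis b
  have : Finite {l // δ l = n} := Finite.of_injective
    (fun l : {l // δ l = n} => (⟨(0, l.1), by simpa using l.2⟩ : {p : ℕ × Λ // p.1 + δ p.2 = n}))
    fun l l' h => by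
      have := congrArg (fun p => p.1.2) h
      exact Subtype.ext this
  obtain ⟨b'⟩ := nonempty_basis_deg (U := U.tensor f g) (tensorBasis e) δ
    (tensorBasis_mem_deg e δ he) n
  exact Module.Finite.of_basis b'

/-- Over a pair of exact zero divisors, a semi-free dg module structure on a minimal free
resolution over `Q` yields a minimal free resolution over `Q/(f)`. -/
theorem IsMinimalFreeResolution.isMinimalFreeResolutionTensor [IsLocalRing Q]
    [IsLocalRing (Q ⧸ Ideal.span {f})]
    {M : Type u} [AddCommGroup M] [Module Q M] [Module (Q ⧸ Ideal.span {f}) M]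
    [IsScalarTower Q (Q ⧸ Ideal.span {f}) M] {ε : U →ₗ[Q] M} (h : U.IsMinimalFreeResolution ε)
    (hfg : IsExactZeroDivisorPair f g) (hs : IsSemiFree f g U) :
    IsMinimalFreeResolutionTensor f g U ε := by
  obtain ⟨Λ, e, he⟩ := hs
  choose δ he using he
  let ε' : TensorCarrier f g U →ₗ[Q ⧸ Ideal.span {f}] M :=
    (tensorBasis e).constr (Q ⧸ Ideal.span {f}) fun l => ε (e l)
  -- On yₙ e_l with n > 0 both sides vanish: the element dies in the tensor product, and it has
  -- positive degree, where the augmentation is zero.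
  have hε' : ∀ u : U, ε' (U.toTensor u) = ε u := by
    intro u
    have hu : u ∈ Submodule.span Q (Set.range (semiFreeBasis e)) := by
      rw [(semiFreeBasis e).span_eq]; trivial
    induction hu using Submodule.span_induction with
    | zero => simp only [map_zero]
    | add x y _ _ hx hy => simp only [map_add, hx, hy]
    | smul r x _ hx =>
      rw [toTensor_smul, map_smul, map_smul, hx]
      exact algebraMap_smul (Q ⧸ Ideal.span {f}) r (ε x)
    | mem x hx =>
      obtain ⟨⟨n, l⟩, rfl⟩ := hx
      match n with
      | 0 =>
        rw [semiFreeBasis_apply]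
        simp only
        rw [← one_def, one_smul, ← tensorBasis_apply]
        exact (tensorBasis e).constr_basis ..
      | n + 1 =>
        have h1 := semiFreeBasis_mem_deg e δ he (n + 1, l)
        have h2 : n + 1 + δ l = n + δ l + 1 := by omega
        simp only [h2] at h1
        rw [h.ε_deg_succ _ _ h1, semiFreeBasis_apply]
        simp only
        rw [toTensor_y_smul U (Nat.succ_ne_zero n), map_zero]
  have := h.finite
  have htd : ∀ u : U, (U.tensor f g).d (U.toTensor u : TensorCarrier f g U) = U.toTensor (U.d u) :=
    tensor_d_toTensor
  refine ⟨ε', hε', ⟨?_, ?_, ?_, ?_, ?_, ?_, ?_⟩⟩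
  · exact free_deg (U := U.tensor f g) (tensorBasis e) δ (tensorBasis_mem_deg e δ he)
  · exact fun n => finite_tensorDeg e δ he n
  · intro n x hx
    obtain ⟨u, hu, rfl⟩ := exists_of_mem_tensorDeg hx
    exact (hε' u).trans (h.ε_deg_succ n u hu)
  · intro m
    obtain ⟨u, rfl⟩ := h.ε_surjective m
    exact ⟨_, hε' u⟩
  · intro x hx
    obtain ⟨u, hu, rfl⟩ := exists_of_mem_tensorDeg hx
    constructor
    · intro h0
      obtain ⟨v, hv, hvu⟩ := (h.exact_zero u hu).1 ((hε' u).symm.trans h0)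
      exact ⟨_, toTensor_mem_tensorDeg hv, (htd v).trans (congrArg _ hvu)⟩
    · rintro ⟨y, hy, hyx⟩
      obtain ⟨v, hv, rfl⟩ := exists_of_mem_tensorDeg hy
      rw [← hyx, htd]
      exact (hε' _).trans ((h.exact_zero _ (U.d_deg_succ 0 v hv)).2 ⟨v, hv, rfl⟩)
  · intro n x hx
    obtain ⟨u, hu, rfl⟩ := exists_of_mem_tensorDeg hx
    constructor
    · intro h0
      -- ∂u is a cycle in the acyclic kernel of U → U ⊗_A R, so ∂u = ∂w with `w` in that kernel.
      -- After passing to the component of `w` of degree n + 1, the difference u - w is a cycle of U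
      -- with the same image as u, and exactness of U applies.
      obtain ⟨w, hw0, hw⟩ := exists_d_eq_of_toTensor_eq_zero e δ he hfg (U.d_d u)
        ((htd u).symm.trans h0)
      have hw0' : (U.toTensor (U.proj (n + 1) w) : TensorCarrier f g U) = 0 := by
        rw [← U.tensorMap_toTensor (U.proj (n + 1)) fun _ => toTensor_proj_y_smul U (n + 1), hw0,
          map_zero]
      have hw' : U.d (u - U.proj (n + 1) w) = 0 := by
        rw [map_sub, U.d_proj_succ, hw, U.proj_of_mem (U.d_deg_succ n u hu), if_pos rfl, sub_self]
      obtain ⟨v, hv, hvu⟩ := (h.exact_succ n _ (sub_mem hu (U.proj_mem (n + 1) w))).1 hw'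
      refine ⟨_, toTensor_mem_tensorDeg hv, (htd v).trans ?_⟩
      rw [hvu, map_sub, hw0', sub_zero]
    · rintro ⟨y, -, hyx⟩
      rw [← hyx]
      exact (U.tensor f g).d_d y
  · intro x
    obtain ⟨u, rfl⟩ := toTensor_surjective (f := f) (g := g) (U := U) x
    have hd := h.minimal u
    have key : ∀ w ∈ maximalIdeal Q • (⊤ : Submodule Q U), (U.toTensor w : TensorCarrier f g U) ∈
        maximalIdeal (Q ⧸ Ideal.span {f}) •
          (⊤ : Submodule (Q ⧸ Ideal.span {f}) (TensorCarrier f g U)) := by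
      intro w hw
      have hloc : IsLocalHom (Ideal.Quotient.mk (Ideal.span {f})) :=
        .of_surjective _ Ideal.Quotient.mk_surjective
      induction hw using Submodule.smul_induction_on' with
      | smul r hr w _ =>
        rw [toTensor_smul]
        refine Submodule.smul_mem_smul ?_ trivial
        exact map_nonunit _ r hr
      | add x _ y _ hx hy => rw [map_add]; exact add_mem hx hy
    have h3 := key _ hd
    rw [← htd] at h3
    exact h3

end TensorResolution

/-! ### Comparison of Betti numbers. -/

section Betti

variable {Q : Type u} [CommRing Q] [IsLocalRing Q] {f g : Q}
  [IsLocalRing (Q ⧸ Ideal.span {f})]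

theorem IsMinimalFreeResolution.poincareSeries_eq {U : GradedComplex Q}
    [Module (TateAlgebra f g) U] [IsDGModule f g U]
    {M : Type u} [AddCommGroup M] [Module Q M] [Module (Q ⧸ Ideal.span {f}) M]
    {ε : U →ₗ[Q] M} (h : U.IsMinimalFreeResolution ε)
    (hs : IsSemiFree f g U) (ht : IsMinimalFreeResolutionTensor f g U ε) :
    poincareSeries (Q ⧸ Ideal.span {f}) M = (1 - PowerSeries.X) * poincareSeries Q M := by
  obtain ⟨Λ, e, he⟩ := hs
  choose δ he using he
  obtain ⟨ε', -, ht⟩ := ht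
  have hQ : ∀ n, bettiNumber Q M n = Nat.card {p : ℕ × Λ // p.1 + δ p.2 = n} := fun n =>
    (h.bettiNumber_eq n).trans
      (finrank_deg (semiFreeBasis e) _ (semiFreeBasis_mem_deg e δ he) n)
  have hR : ∀ n, bettiNumber (Q ⧸ Ideal.span {f}) M n = Nat.card {l // δ l = n} := fun n =>
    (ht.bettiNumber_eq n).trans
      (finrank_deg (U := U.tensor f g) (tensorBasis e) δ (tensorBasis_mem_deg e δ he) n)
  have hfin : ∀ n, Finite {p : ℕ × Λ // p.1 + δ p.2 = n} := fun n => by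
    have := h.finite
    obtain ⟨b⟩ := nonempty_basis_deg (semiFreeBasis e) _ (semiFreeBasis_mem_deg e δ he) n
    exact Module.Finite.finite_basis b
  have h0 : Nat.card {p : ℕ × Λ // p.1 + δ p.2 = 0} = Nat.card {l // δ l = 0} :=
    Nat.card_congr
      { toFun := fun p => ⟨p.1.2, by have := p.2; omega⟩
        invFun := fun l => ⟨(0, l.1), by have := l.2; simp only; omega⟩
        left_inv := by
          rintro ⟨⟨i, l⟩, hp⟩
          simp only at hp
          obtain rfl : i = 0 := by omega
          rfl
        right_inv := fun l => rfl }
  -- A basis element of degree n + 1 is either some e_l or arises from one of degree n by raising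
  -- the index of y by one. This is the recursion encoded by the factor 1 - t.
  have hsucc : ∀ n, Nat.card {p : ℕ × Λ // p.1 + δ p.2 = n + 1} =
      Nat.card {l // δ l = n + 1} + Nat.card {p : ℕ × Λ // p.1 + δ p.2 = n} := by
    intro n
    have := hfin n
    have := hfin (n + 1)
    let E : {l // δ l = n + 1} ⊕ {p : ℕ × Λ // p.1 + δ p.2 = n} ≃
        {p : ℕ × Λ // p.1 + δ p.2 = n + 1} :=
      { toFun := Sum.elim (fun l => ⟨(0, l.1), by have := l.2; simp only; omega⟩)
          (fun p => ⟨(p.1.1 + 1, p.1.2), by have := p.2; simp only; omega⟩)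
        invFun := fun p => match p with
          | ⟨(0, l), hp⟩ => Sum.inl ⟨l, by simpa using hp⟩
          | ⟨(i + 1, l), hp⟩ => Sum.inr ⟨(i, l), by simp only at hp ⊢; omega⟩
        left_inv := by rintro (l | p) <;> rfl
        right_inv := by rintro ⟨⟨_ | i, l⟩, hp⟩ <;> rfl }
    have : Finite {l // δ l = n + 1} := Finite.of_injective _ (E.injective.comp Sum.inl_injective)
    rw [← Nat.card_congr E, Nat.card_sum]
  ext n
  rw [sub_mul, one_mul, map_sub]
  match n with
  | 0 =>
    rw [PowerSeries.coeff_zero_X_mul, sub_zero, poincareSeries, poincareSeries,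
      PowerSeries.coeff_mk, PowerSeries.coeff_mk, hQ, hR, h0]
  | n + 1 =>
    rw [PowerSeries.coeff_succ_X_mul, poincareSeries, poincareSeries,
      PowerSeries.coeff_mk, PowerSeries.coeff_mk, PowerSeries.coeff_mk, hQ, hQ, hR, hsucc]
    push_cast
    ring

end Betti

/-! ### Betti numbers of the ring over itself. -/

section RankOne

variable {R : Type u} [CommRing R] [IsLocalRing R]

theorem bettiNumber_self (n : ℕ) : bettiNumber R R n = if n = 0 then 1 else 0 := by
  let b : ℕ → ℕ := fun n => if n = 0 then 1 else 0
  have hsub : ∀ n, Subsingleton (Fin (b (n + 1)) → R) := fun n => by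
    simp only [b, Nat.succ_ne_zero, if_false]
    infer_instance
  let p₀ : (Fin (b 0) → R) →ₗ[R] R := LinearMap.proj ⟨0, Nat.one_pos⟩
  have hker : LinearMap.ker p₀ = ⊥ := by
    rw [LinearMap.ker_eq_bot']
    intro x hx
    funext i
    have : i = ⟨0, Nat.one_pos⟩ := Fin.ext (Nat.lt_one_iff.1 i.2)
    rw [this]
    exact hx
  obtain ⟨F, ε, h, hF⟩ := ofSequence_isMinimalFreeResolution (Q := R) (fun n => Fin (b n) → R)
    (fun n => 0) p₀ (fun r => ⟨fun _ => r, rfl⟩) (by rw [hker, LinearMap.range_zero])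
    (fun n => by
      rw [LinearMap.range_zero, eq_comm, eq_bot_iff]
      intro x _
      exact (Submodule.mem_bot R).2 (@Subsingleton.elim _ (hsub n) x 0))
    (fun n => by rw [LinearMap.range_zero]; exact bot_le)
  obtain ⟨E⟩ := hF n
  rw [h.bettiNumber_eq, E.finrank_eq, Module.finrank_fintype_fun_eq_card, Fintype.card_fin]

end RankOne

/-! ### Recovering exactness from Betti numbers equal to 1. -/

section Converse

variable {Q : Type u} [CommRing Q] [IsLocalRing Q]

/-- If all Betti numbers of `Q/(f)` over `Q` are `1` then the differentials of the minimal free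
resolution are multiplications by elements `h₀, h₁, …`, and each generates the annihilator of
its predecessor. -/
theorem exists_sequence_of_bettiNumber_eq_one [IsNoetherianRing Q] (f : Q)
    (hβ : ∀ n, bettiNumber Q (Q ⧸ Ideal.span {f}) n = 1) :
    ∃ h : ℕ → Q, (∀ n, h n ∈ maximalIdeal Q) ∧ (∀ a, a ∈ Ideal.span {f} ↔ ∃ q, a = q * h 0) ∧
      ∀ n a, a * h n = 0 ↔ ∃ q, a = q * h (n + 1) := by
  obtain ⟨U, ε, hU⟩ := exists_isMinimalFreeResolution (Q := Q) (Q ⧸ Ideal.span {f})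
  have := hU.free
  have := hU.finite
  have hb : ∀ n, ∃ b ∈ U.deg n, (∀ u ∈ U.deg n, ∃ q : Q, u = q • b) ∧
      (∀ q : Q, q • b = 0 → q = 0) ∧
      ∀ q : Q, q • b ∈ maximalIdeal Q • (⊤ : Submodule Q U) → q ∈ maximalIdeal Q := by
    intro n
    let c := Module.finBasisOfFinrankEq Q (U.deg n) ((hU.bettiNumber_eq n).symm.trans (hβ n))
    have hc : ∀ q : Q, c.repr (q • c 0) 0 = q := fun q => by simp
    refine ⟨c 0, (c 0).2, fun u hu => ⟨c.repr ⟨u, hu⟩ 0, ?_⟩, fun q hq => ?_, fun q hq => ?_⟩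
    · have := congrArg (U.deg n).subtype (c.sum_repr ⟨u, hu⟩)
      simpa using this.symm
    · have h0 : q • c 0 = 0 := Subtype.ext hq
      rw [← hc q, h0, c.repr.map_zero, Finsupp.zero_apply]
    · have h0 := U.mem_smul_top_deg _ (q • c 0) hq
      have := (c.mem_smul_top_iff_repr _ _).1 h0 0
      rwa [hc] at this
  choose b hbm hgen hfree hmax using hb
  choose h hh using fun n => hgen n _ (U.d_deg_succ n _ (hbm (n + 1)))
  refine ⟨h, fun n => hmax n _ (hh n ▸ hU.minimal _), fun a => ?_, fun n a => ?_⟩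
  · obtain ⟨⟨u, hu⟩, hu1⟩ := hU.surjective_domRestrict 1
    obtain ⟨s, rfl⟩ := hgen 0 u hu
    have hu2 : s • ε (b 0) = 1 := by rw [← map_smul]; exact hu1
    have h1 : a ∈ Ideal.span {f} ↔ ε (a • b 0) = 0 := by
      rw [← Ideal.Quotient.eq_zero_iff_mem]
      constructor
      · intro ha
        rw [map_smul, Algebra.smul_def]
        change Ideal.Quotient.mk _ a * _ = 0
        rw [ha, zero_mul]
      · intro ha
        have h2 : a • (1 : Q ⧸ Ideal.span {f}) = 0 := by
          rw [← hu2, smul_comm, ← map_smul, ha, smul_zero]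
        rw [Algebra.smul_def, mul_one] at h2
        exact h2
    rw [h1, hU.exact_zero _ (Submodule.smul_mem _ _ (hbm 0))]
    constructor
    · rintro ⟨v, hv, hva⟩
      obtain ⟨q, rfl⟩ := hgen 1 v hv
      refine ⟨q, ?_⟩
      rw [map_smul, hh, smul_smul] at hva
      rw [← sub_eq_zero]
      exact hfree 0 _ (by rw [sub_smul, hva, sub_self])
    · rintro ⟨q, rfl⟩
      exact ⟨q • b 1, Submodule.smul_mem _ _ (hbm 1), by rw [map_smul, hh, smul_smul]⟩
  · have h1 : a * h n = 0 ↔ U.d (a • b (n + 1)) = 0 := by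
      rw [map_smul, hh, smul_smul]
      exact ⟨fun h0 => by rw [h0, zero_smul], hfree n _⟩
    rw [h1, hU.exact_succ n _ (Submodule.smul_mem _ _ (hbm (n + 1)))]
    constructor
    · rintro ⟨v, hv, hva⟩
      obtain ⟨q, rfl⟩ := hgen (n + 2) v hv
      refine ⟨q, ?_⟩
      rw [map_smul, hh (n + 1), smul_smul] at hva
      rw [← sub_eq_zero]
      exact hfree (n + 1) _ (by rw [sub_smul, hva, sub_self])
    · rintro ⟨q, rfl⟩
      exact ⟨q • b (n + 2), Submodule.smul_mem _ _ (hbm (n + 2)),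
        by rw [map_smul, hh (n + 1), smul_smul]⟩

/-- Each `h n` lies in 𝔫, so an element outside 𝔫² that is a multiple of `h n` is a unit multiple of
it. This applies to g, which kills h₀, and to f, which kills h₁ once h₁ is known to be a multiple of
g. The annihilators of f and g are then bounded by those of h₀ and h₁. -/
theorem isExactZeroDivisorPair_of_bettiNumber_eq_one [IsNoetherianRing Q] {f g : Q}
    (hf2 : f ∉ maximalIdeal Q ^ 2) (hg2 : g ∉ maximalIdeal Q ^ 2) (hfg : f * g = 0)
    (hβ : ∀ n, bettiNumber Q (Q ⧸ Ideal.span {f}) n = 1) : IsExactZeroDivisorPair f g := by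
  obtain ⟨h, hm, h0, hs⟩ := exists_sequence_of_bettiNumber_eq_one f hβ
  have hunit : ∀ {x q : Q} {n : ℕ}, x ∉ maximalIdeal Q ^ 2 → x = q * h n → IsUnit q := by
    rintro x q n hx rfl
    by_contra hq
    exact hx (by rw [pow_two]; exact Ideal.mul_mem_mul ((mem_maximalIdeal q).2 hq) (hm n))
  have hann : ∀ {x y : Q}, x * y = 0 → (∀ a, a * x = 0 → ∃ q, a = q * y) →
      (Ideal.span {x}).annihilator = Ideal.span {y} := by
    intro x y hxy hx
    ext a
    rw [← Ideal.submodule_span_eq, Submodule.mem_annihilator_span_singleton, smul_eq_mul,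
      Ideal.mem_span_singleton']
    constructor
    · intro ha
      obtain ⟨q, rfl⟩ := hx a ha
      exact ⟨q, rfl⟩
    · rintro ⟨q, rfl⟩
      rw [mul_assoc, mul_comm y, hxy, mul_zero]
  -- Only the inclusion (h₀) ⊆ (f) is used: it makes annihilators of f annihilate h₀.
  obtain ⟨s, hsf⟩ := Ideal.mem_span_singleton'.1 ((h0 (h 0)).2 ⟨1, (one_mul _).symm⟩)
  obtain ⟨q, hq⟩ := (hs 0 g).1 (by rw [← hsf, mul_comm s, ← mul_assoc, mul_comm g, hfg, zero_mul])
  obtain ⟨v, hv⟩ := (hunit hg2 hq).exists_left_inv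
  have hh1 : h 1 = v * g := by rw [hq, ← mul_assoc, hv, one_mul]
  obtain ⟨p, hp⟩ := (hs 1 f).1 (by rw [hh1, mul_left_comm, hfg, mul_zero])
  obtain ⟨t, ht⟩ := (hunit hf2 hp).exists_left_inv
  have hh2 : h 2 = t * f := by rw [hp, ← mul_assoc, ht, one_mul]
  constructor
  · refine hann hfg fun a ha => ?_
    obtain ⟨c, rfl⟩ := (hs 0 a).1 (by rw [← hsf, mul_left_comm, ha, mul_zero])
    exact ⟨c * v, by rw [hh1, mul_assoc]⟩
  · refine hann (by rw [mul_comm, hfg]) fun a ha => ?_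
    obtain ⟨c, rfl⟩ := (hs 1 a).1 (by rw [hh1, mul_left_comm, ha, mul_zero])
    exact ⟨c * t, by rw [hh2, mul_assoc]⟩

end Converse

end GradedComplex

/-! ### The equivalence. -/

theorem corollary2p4 {Q : Type u} [CommRing Q] [IsLocalRing Q] [IsNoetherianRing Q] (f g : Q)
    (hf : f ∈ IsLocalRing.maximalIdeal Q) (hf2 : f ∉ IsLocalRing.maximalIdeal Q ^ 2)
    (hg : g ∈ IsLocalRing.maximalIdeal Q) (hg2 : g ∉ IsLocalRing.maximalIdeal Q ^ 2)
    (hfg : f * g = 0) :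
    haveI : IsLocalRing (Q ⧸ Ideal.span {f}) := isLocalRing_quotient_span hf
    List.TFAE [
      -- (1)
      IsExactZeroDivisorPair f g,
      -- (2), for some semi-free dg module structure on `U`
      ∀ (M : Type u) [AddCommGroup M] [Module Q M] [Module (Q ⧸ Ideal.span {f}) M]
        [IsScalarTower Q (Q ⧸ Ideal.span {f}) M] [Module.Finite (Q ⧸ Ideal.span {f}) M]
        (U : GradedComplex Q) (ε : U →ₗ[Q] M), U.IsMinimalFreeResolution ε →
        ∃ (_ : Module (TateAlgebra f g) U) (_ : IsDGModule f g U),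
          IsSemiFree f g U ∧ IsMinimalFreeResolutionTensor f g U ε,
      -- (2), for every semi-free dg module structure on `U`
      ∀ (M : Type u) [AddCommGroup M] [Module Q M] [Module (Q ⧸ Ideal.span {f}) M]
        [IsScalarTower Q (Q ⧸ Ideal.span {f}) M] [Module.Finite (Q ⧸ Ideal.span {f}) M]
        (U : GradedComplex Q) (ε : U →ₗ[Q] M), U.IsMinimalFreeResolution ε →
        ∀ [Module (TateAlgebra f g) U] [IsDGModule f g U],
          IsSemiFree f g U → IsMinimalFreeResolutionTensor f g U ε,
      -- (3)
      ∀ (M : Type u) [AddCommGroup M] [Module Q M] [Module (Q ⧸ Ideal.span {f}) M]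
        [IsScalarTower Q (Q ⧸ Ideal.span {f}) M] [Module.Finite (Q ⧸ Ideal.span {f}) M],
        poincareSeries (Q ⧸ Ideal.span {f}) M = (1 - PowerSeries.X) * poincareSeries Q M] := by

  have hloc : IsLocalRing (Q ⧸ Ideal.span {f}) := isLocalRing_quotient_span hf
  have hfM : ∀ (M : Type u) [AddCommGroup M] [Module Q M] [Module (Q ⧸ Ideal.span {f}) M]
      [IsScalarTower Q (Q ⧸ Ideal.span {f}) M] (m : M), f • m = 0 := by
    intro M _ _ _ _ m
    have h0 : algebraMap Q (Q ⧸ Ideal.span {f}) f = 0 :=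
      Ideal.Quotient.eq_zero_iff_mem.2 (Ideal.mem_span_singleton_self f)
    rw [← algebraMap_smul (Q ⧸ Ideal.span {f}) f m, h0, zero_smul]
  -- The numerals are list positions: 2 is existence of a good structure, 3 concerns all structures,
  -- 4 is the identity of Poincaré series.
  tfae_have 1 → 3 := by
    intro h M _ _ _ _ _ U ε hU _ _ hs
    exact hU.isMinimalFreeResolutionTensor h hs
  tfae_have 3 → 2 := by
    intro h M _ _ _ _ _ U ε hU
    obtain ⟨i, j, hs⟩ := hU.exists_semiFree (hfM M) hfg hf2 hg2
    exact ⟨i, j, hs, h M U ε hU hs⟩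
  tfae_have 2 → 4 := by
    intro h M _ _ _ _ _
    have : Module.Finite Q M := Module.Finite.trans (Q ⧸ Ideal.span {f}) M
    obtain ⟨U, ε, hU⟩ := GradedComplex.exists_isMinimalFreeResolution (Q := Q) M
    obtain ⟨i, j, hs, ht⟩ := h M U ε hU
    exact hU.poincareSeries_eq hs ht
  tfae_have 4 → 1 := by
    intro h
    refine GradedComplex.isExactZeroDivisorPair_of_bettiNumber_eq_one hf2 hg2 hfg fun n => ?_
    -- With M = R the left side is 1. Comparing coefficients gives β₀ = 1 and βₙ₊₁ = βₙ over Q.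
    have h1 := h (Q ⧸ Ideal.span {f})
    induction n with
    | zero =>
      have h2 := congrArg (PowerSeries.coeff 0) h1
      rw [sub_mul, one_mul, map_sub, PowerSeries.coeff_zero_X_mul, sub_zero, poincareSeries,
        poincareSeries, PowerSeries.coeff_mk, PowerSeries.coeff_mk,
        GradedComplex.bettiNumber_self, if_pos rfl] at h2
      exact_mod_cast h2.symm
    | succ n ih =>
      have h2 := congrArg (PowerSeries.coeff (n + 1)) h1
      rw [sub_mul, one_mul, map_sub, PowerSeries.coeff_succ_X_mul, poincareSeries,
        poincareSeries, PowerSeries.coeff_mk, PowerSeries.coeff_mk, PowerSeries.coeff_mk,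
        GradedComplex.bettiNumber_self, if_neg (Nat.succ_ne_zero n), ih] at h2
      push_cast at h2
      omega
  tfae_finish
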